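/- Let $f$ be a real function on $[0,\infty)$ that admits a Taylor expansion near $0$ with infinitely many non-zero even-order coefficients; that is, there are reals $a_0,a_1,\dots$ such that $f(x)=\sum_{k<n}a_kx^k+O(x^n)$ as $x\to0^+$ (and at $x=0$) for every $n\ge 0$, and $a_k\neq0$ for infinitely many even $k$. For a matrix $X\in\mathbb R^{N\times N}$ with singular values $\sigma_1(X)\ge\dots\ge\sigma_N(X)\ge 0$ put $F(X)=\sum_{i=1}^N f(\sigma_i(X))$. A data stream algorithm with $S$ bits of space is a randomized one-pass algorithm that reads a sequence of updates $(i,j,v)$, meaning $X_{ij}\leftarrow X_{ij}+v$ (initially $X=0$), and keeps only $S$ bits of memory between updates; its random string and the number of updates read so far are available free of charge, and it may depend on $N$. It outputs a $(1+c)$-approximation to $F(X)$ with error probability $\delta$ on a stream if, except with probability at most $\delta$, its output $Y$ satisfies $|Y-F(X)|\le c\,|F(X)|$, where $X$ is the matrix at the end of the stream. Then for every integer $m\ge1$ there is a constant $c>0$, depending only on $f$ and $m$, such that any data stream algorithm which outputs, with constant error probability $\delta<1/2$, a $(1+c)$-approximation to $F(X)$ requires $\Omega(N^{1-1/m})$ bits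 of space, i.e. at least $C\,N^{1-1/m}$ bits for all sufficiently large $N$, where $C>0$ and the threshold for $N$ depend only on $f$, $m$ and $\delta$. This holds even for bounded-precision, insertion-only streams: there is an integer $q\ge1$, depending only on $f$ and $m$, such that the bound holds for every algorithm that is only required to succeed on streams in which every entry of $X$ is updated at most once and every update adds $v=1/q$. -/

import Mathlib

open Filter Asymptotics MeasureTheory
open scoped Topology

/-- `f` admits the Taylor expansion `∑ aₖ xᵏ` near `0`, to every order. Only `x ≥ 0` matters, since
`f` is applied to singular values. Every function which on some `[0, r)` is the sum of a convergent
power series, or which is smooth near `0`, has such an expansion. -/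
def HasTaylorExpansion (f : ℝ → ℝ) (a : ℕ → ℝ) : Prop :=
  ∀ n : ℕ, (fun x => f x - ∑ k ∈ Finset.range n, a k * x ^ k) =O[𝓝[≥] 0] fun x => x ^ n

/-- `∑ i, f (σᵢ(X))`, over all `N` singular values of the `N × N` matrix `X`
(with multiplicity, zeros included). -/
noncomputable def spectralSum (f : ℝ → ℝ) {N : ℕ} (X : Matrix (Fin N) (Fin N) ℝ) : ℝ :=
  ∑ i : Fin N, f ((Matrix.toEuclideanLin X).singularValues i)

/-- An update `(i, j, v)` stands for `X i j ← X i j + v`. -/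
abbrev Update (N : ℕ) : Type := Fin N × Fin N × ℝ

/-- The matrix described by a stream of updates, starting from the zero matrix. -/
def streamMatrix {N : ℕ} (s : List (Update N)) : Matrix (Fin N) (Fin N) ℝ :=
  (s.map fun u => Matrix.single u.1 u.2.1 u.2.2).sum

/-- Insertion-only streams of entries of size `ε`: every entry of the matrix is updated at most
once, and every update adds `ε`. -/
def IsInsertionStream {N : ℕ} (ε : ℝ) (s : List (Update N)) : Prop :=
  (s.map fun u => (u.1, u.2.1)).Nodup ∧ ∀ u ∈ s, u.2.2 = ε

/-- A randomized one-pass streaming algorithm for `N × N` matrices using `S` bits of space: between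
two updates it remembers nothing but `S` bits. A random string `ω`, which can be read at any time,
and the number of updates read so far are given to it free of charge; the maps may be arbitrary and
may depend on `N`. -/
structure StreamingAlgorithm (N S : ℕ) where
  /-- the random strings -/
  Ω : Type
  [measurableSpace : MeasurableSpace Ω]
  /-- their distribution -/
  μ : Measure Ω
  [isProbabilityMeasure : IsProbabilityMeasure μ]
  /-- the memory at the start -/
  init : Ω → (Fin S → Bool)
  /-- the new memory, from the number of updates read before, the memory and the next update -/
  step : Ω → ℕ → (Fin S → Bool) → Update N → (Fin S → Bool)
  /-- the answer, from the length of the stream and the memory at its end -/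
  output : Ω → ℕ → (Fin S → Bool) → ℝ

namespace StreamingAlgorithm

variable {N S : ℕ} (A : StreamingAlgorithm N S)

/-- The memory after reading the stream, from memory `x` after `t` earlier updates. -/
def memoryFrom (ω : A.Ω) : ℕ → (Fin S → Bool) → List (Update N) → (Fin S → Bool)
  | _, x, [] => x
  | t, x, u :: s => memoryFrom ω (t + 1) (A.step ω t x u) s

/-- The answer of the algorithm on the stream `s`. -/
def answer (ω : A.Ω) (s : List (Update N)) : ℝ :=
  A.output ω s.length (A.memoryFrom ω 0 (A.init ω) s)

/-- On every stream in the class `P`, the algorithm outputs a `(1 ± c)`-approximation to the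
quantity `F` of the matrix of the stream, except with probability at most `δ`. -/
def Approximates (F : Matrix (Fin N) (Fin N) ℝ → ℝ) (c δ : ℝ) (P : List (Update N) → Prop) :
    Prop :=
  ∀ s, P s →
    A.μ {ω | ¬ |A.answer ω s - F (streamMatrix s)| ≤ c * |F (streamMatrix s)|} ≤ ENNReal.ofReal δ

end StreamingAlgorithm

/-! ### Characters of the discrete cube and hypercontractivity -/

/-! The proof is a reduction from one-way communication for the Boolean hidden hypermatching problem
with hyperedges of size `t = m + 2`. Alice holds bits `x` on `n` items. Bob holds `r` disjoint
random hyperedges and a vector `w`, and must tell whether `w` is the vector of parities of `x` over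
the hyperedges or its complement.

Each item becomes two rows and two columns. Alice joins them straight or crossed according to its
bit, and Bob joins the items of each hyperedge cyclically, with a twist by `w j`. A hyperedge is
then a double cover of a cycle with monodromy parity plus `w j`: two short cycles if this is `0`,
one cycle of twice the length if it is `1`. Up to permutations of rows and columns, every such block
is `ε (1 + permutation)` (`streamMatrix_reduction`, `spectralSum_reduction`).

The two covers have different sums of even powers `2p` of their singular values for all `p ≥ t`,
because only the shorter cycles close up after `t` steps (`trace_coverMatrix_lt`). Since `f` has a
nonzero even coefficient of high order, it separates the covers at some scale `ε = 1/q`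
(`exists_singularSum_coverMatrix_ne`). The gap is proportional to `r`, hence to `N`, so a
constant-factor approximation decides the parity problem, with the memory after Alice's updates as
the message (`one_sub_le_sum_levelBound`).

For the communication bound, a test of parities against their complements has mean zero, so only
characters over nonempty unions of hyperedges contribute. Such a union of `k` hyperedges is a
uniformly random set of `k * t` items, so the advantage is governed by the Fourier weight of the
message classes at level `k * t` (`sum_parity_advantage_le`). Bonami's inequality bounds this weight
for a partition into `2 ^ S` classes (`sum_sqrt_levelWeight_pow_le`), and the total tends to `0` for
`S < N ^ (1 - 1/m)` (`exists_sum_levelBound_le`). -/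

theorem sum_range_two_mul_add_one (g : ℕ → ℝ) (q : ℕ) :
    ∑ k ∈ Finset.range (2 * q + 1), g k =
      ∑ j ∈ Finset.range (q + 1), g (2 * j) + ∑ j ∈ Finset.range q, g (2 * j + 1) := by
  induction q with
  | zero => simp
  | succ q ih =>
    rw [show 2 * (q + 1) + 1 = 2 * q + 1 + 1 + 1 by ring, Finset.sum_range_succ,
      Finset.sum_range_succ, ih, Finset.sum_range_succ _ (q + 1),
      Finset.sum_range_succ (fun j => g (2 * j + 1)) q, show 2 * (q + 1) = 2 * q + 1 + 1 by ring]
    ring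

/-- Induction on `j`: passing from `j` to `j + 1`, the growth of the left binomial divided by that
of the right one is `(2 (q - j) - 1) / (2 j + 1)`, at most `2 q`. -/
theorem choose_two_mul_le (q j : ℕ) : (2 * q).choose (2 * j) ≤ (2 * q) ^ j * q.choose j := by
  induction j with
  | zero => simp
  | succ j ih =>
    rcases le_or_gt q j with h | h
    · rw [Nat.choose_eq_zero_of_lt (by omega : 2 * q < 2 * (j + 1))]
      exact Nat.zero_le _
    obtain ⟨d, rfl⟩ : ∃ d, q = j + 1 + d := ⟨q - (j + 1), by omega⟩
    have e1 := Nat.choose_succ_right_eq (2 * (j + 1 + d)) (2 * j)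
    have e2 := Nat.choose_succ_right_eq (2 * (j + 1 + d)) (2 * j + 1)
    have e3 := Nat.choose_succ_right_eq (j + 1 + d) j
    rw [show 2 * (j + 1 + d) - 2 * j = 2 * (d + 1) by omega] at e1
    rw [show 2 * (j + 1 + d) - (2 * j + 1) = 2 * d + 1 by omega] at e2
    rw [show j + 1 + d - j = d + 1 by omega] at e3
    rw [show 2 * (j + 1) = 2 * j + 1 + 1 by ring]
    set q := j + 1 + d with hq
    refine Nat.le_of_mul_le_mul_left (c := (2 * j + 1) * (2 * j + 2)) ?_ (by positivity)
    calc (2 * j + 1) * (2 * j + 2) * (2 * q).choose (2 * j + 1 + 1)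
        = (2 * q).choose (2 * j) * (2 * (d + 1)) * (2 * d + 1) := by
          rw [← e1]
          linear_combination (2 * j + 1) * e2
      _ ≤ (2 * q) ^ j * q.choose j * (2 * (d + 1)) * (2 * d + 1) := by gcongr
      _ = (2 * q) ^ j * 2 * (2 * d + 1) * (q.choose j * (d + 1)) := by ring
      _ = (2 * q) ^ j * 2 * (2 * d + 1) * (q.choose (j + 1) * (j + 1)) := by rw [e3]
      _ ≤ (2 * q) ^ j * 2 * ((2 * j + 1) * (2 * q)) * (q.choose (j + 1) * (j + 1)) := by
          gcongr
          nlinarith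
      _ = _ := by ring

/-- The two-point hypercontractive inequality for even exponents. -/
theorem two_point_inequality (A B : ℝ) (q : ℕ) :
    (A + B) ^ (2 * q) + (A - B) ^ (2 * q) ≤ 2 * (A ^ 2 + 2 * q * B ^ 2) ^ q := by
  have h1 : (A + B) ^ (2 * q) + (A - B) ^ (2 * q) =
      2 * ∑ j ∈ Finset.range (q + 1), (B ^ 2) ^ j * (A ^ 2) ^ (q - j) * (2 * q).choose (2 * j) := by
    rw [add_comm A B, sub_eq_neg_add, add_pow, add_pow, sum_range_two_mul_add_one,
      sum_range_two_mul_add_one, Finset.mul_sum]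
    have h2 : ∀ j, (-B) ^ (2 * j + 1) * A ^ (2 * q - (2 * j + 1)) * (2 * q).choose (2 * j + 1) =
        -(B ^ (2 * j + 1) * A ^ (2 * q - (2 * j + 1)) * (2 * q).choose (2 * j + 1)) := by
      intro j
      rw [Odd.neg_pow ⟨j, rfl⟩]
      ring
    have h3 : ∀ j, (-B) ^ (2 * j) * A ^ (2 * q - 2 * j) * (2 * q).choose (2 * j) =
        (B ^ 2) ^ j * (A ^ 2) ^ (q - j) * (2 * q).choose (2 * j) := by
      intro j
      rw [Even.neg_pow ⟨j, by ring⟩, ← pow_mul, ← pow_mul, Nat.mul_sub]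
    have h4 : ∀ j, B ^ (2 * j) * A ^ (2 * q - 2 * j) * (2 * q).choose (2 * j) =
        (B ^ 2) ^ j * (A ^ 2) ^ (q - j) * (2 * q).choose (2 * j) := by
      intro j
      rw [← pow_mul, ← pow_mul, Nat.mul_sub]
    simp only [h2, h3, h4, Finset.sum_neg_distrib, ← Finset.mul_sum]
    ring
  rw [h1, add_comm (A ^ 2), add_pow]
  refine mul_le_mul_of_nonneg_left (Finset.sum_le_sum fun j _ => ?_) zero_le_two
  rw [mul_pow]
  have := choose_two_mul_le q j
  have h5 : ((2 * q).choose (2 * j) : ℝ) ≤ (2 * q) ^ j * q.choose j := by exact_mod_cast this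
  calc (B ^ 2) ^ j * (A ^ 2) ^ (q - j) * (2 * q).choose (2 * j)
      ≤ (B ^ 2) ^ j * (A ^ 2) ^ (q - j) * ((2 * q) ^ j * q.choose j) := by gcongr
    _ = _ := by ring

/-- Minkowski's inequality in `L^q`, with the roots removed. It lets Bonami's induction add the
bounds for the two halves of a polynomial. -/
theorem sum_add_pow_le {α : Type*} (s : Finset α) (u v : α → ℝ) (hu : ∀ x ∈ s, 0 ≤ u x)
    (hv : ∀ x ∈ s, 0 ≤ v x) {a b Q : ℝ} (ha : 0 ≤ a) (hb : 0 ≤ b) (hQ : 0 ≤ Q) {q : ℕ} (hq : 1 ≤ q)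
    (h1 : ∑ x ∈ s, u x ^ q ≤ Q * a ^ q) (h2 : ∑ x ∈ s, v x ^ q ≤ Q * b ^ q) :
    ∑ x ∈ s, (u x + v x) ^ q ≤ Q * (a + b) ^ q := by
  have hq0 : q ≠ 0 := by omega
  have hq1 : (1 : ℝ) ≤ q := by exact_mod_cast hq
  have key := Real.Lp_add_le_of_nonneg s hq1 hu hv
  simp only [Real.rpow_natCast] at key
  have aux : ∀ {c d : ℝ}, 0 ≤ c → 0 ≤ d → d ≤ Q * c ^ q →
      d ^ (1 / (q : ℝ)) ≤ Q ^ (1 / (q : ℝ)) * c := by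
    intro c d hc hd h
    calc d ^ (1 / (q : ℝ)) ≤ (Q * c ^ q) ^ (1 / (q : ℝ)) := by gcongr
      _ = Q ^ (1 / (q : ℝ)) * c := by
        rw [Real.mul_rpow hQ (by positivity), one_div, Real.pow_rpow_inv_natCast hc hq0]
  have k1 := aux ha (Finset.sum_nonneg fun x hx => pow_nonneg (hu x hx) q) h1
  have k2 := aux hb (Finset.sum_nonneg fun x hx => pow_nonneg (hv x hx) q) h2
  have h0 : 0 ≤ ∑ x ∈ s, (u x + v x) ^ q :=
    Finset.sum_nonneg fun x hx => pow_nonneg (add_nonneg (hu x hx) (hv x hx)) q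
  have k3 : (∑ x ∈ s, (u x + v x) ^ q) ^ (1 / (q : ℝ)) ≤ Q ^ (1 / (q : ℝ)) * (a + b) := by
    linarith
  have k4 := pow_le_pow_left₀ (Real.rpow_nonneg h0 _) k3 q
  rwa [mul_pow, one_div, Real.rpow_inv_natCast_pow h0 hq0, Real.rpow_inv_natCast_pow hQ hq0] at k4

/-- The sign `(-1) ^ b`. -/
def bitSign (b : ZMod 2) : ℝ := if b = 0 then 1 else -1

theorem bitSign_zero : bitSign 0 = 1 := by simp [bitSign]

theorem bitSign_add (a b : ZMod 2) : bitSign (a + b) = bitSign a * bitSign b := by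
  have h : ∀ c : ZMod 2, c = 0 ∨ c = 1 := by decide
  rcases h a with rfl | rfl <;> rcases h b with rfl | rfl <;>
    simp [bitSign, show (1 : ZMod 2) + 1 = 0 from rfl]

theorem bitSign_mul_self (b : ZMod 2) : bitSign b * bitSign b = 1 := by
  unfold bitSign
  split_ifs <;> norm_num

theorem bitSign_sum {α : Type*} (s : Finset α) (g : α → ZMod 2) :
    bitSign (∑ i ∈ s, g i) = ∏ i ∈ s, bitSign (g i) := by
  classical
  induction s using Finset.induction_on with
  | empty => simp [bitSign_zero]
  | insert a s ha ih => rw [Finset.sum_insert ha, Finset.prod_insert ha, bitSign_add, ih]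

/-- The character of the cube `ι → ZMod 2` with frequency set `V`. -/
def cubeChar {ι : Type*} (V : Finset ι) (x : ι → ZMod 2) : ℝ := ∏ i ∈ V, bitSign (x i)

section Cube

set_option linter.unusedSectionVars false

variable {ι : Type*} [Fintype ι] [DecidableEq ι]

theorem cubeChar_insert {a : ι} {V : Finset ι} (h : a ∉ V) (x : ι → ZMod 2) :
    cubeChar (insert a V) x = bitSign (x a) * cubeChar V x := by
  simp [cubeChar, Finset.prod_insert h]

theorem cubeChar_flip {a : ι} {V : Finset ι} (h : a ∉ V) (x : ι → ZMod 2) :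
    cubeChar V (x + Pi.single a 1) = cubeChar V x := by
  refine Finset.prod_congr rfl fun i hi => ?_
  have : i ≠ a := fun e => h (e ▸ hi)
  simp [this]

/-- Bonami's inequality. -/
theorem sum_pow_cubePolynomial_le {q : ℕ} (hq : 1 ≤ q) (s : Finset ι) (c : Finset ι → ℝ) :
    ∑ x : ι → ZMod 2, (∑ V ∈ s.powerset, c V * cubeChar V x) ^ (2 * q) ≤
      Fintype.card (ι → ZMod 2) * (∑ V ∈ s.powerset, (2 * q : ℝ) ^ V.card * c V ^ 2) ^ q := by
  induction s using Finset.induction_on generalizing c with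
  | empty => simp [cubeChar, ← pow_mul]
  | insert a s ha ih =>
    set P : (ι → ZMod 2) → ℝ := fun x => ∑ V ∈ s.powerset, c V * cubeChar V x with hP
    set R : (ι → ZMod 2) → ℝ := fun x => ∑ V ∈ s.powerset, c (insert a V) * cubeChar V x with hR
    have hnot : ∀ V ∈ s.powerset, a ∉ V := fun V hV h => ha (Finset.mem_powerset.1 hV h)
    have hsplit : ∀ x, ∑ V ∈ (insert a s).powerset, c V * cubeChar V x =
        P x + bitSign (x a) * R x := by
      intro x
      rw [Finset.sum_powerset_insert ha, hP, hR]
      congr 1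
      rw [Finset.mul_sum]
      refine Finset.sum_congr rfl fun V hV => ?_
      rw [cubeChar_insert (hnot V hV)]
      ring
    have hflipP : ∀ x, P (x + Pi.single a 1) = P x := fun x =>
      Finset.sum_congr rfl fun V hV => by rw [cubeChar_flip (hnot V hV)]
    have hflipR : ∀ x, R (x + Pi.single a 1) = R x := fun x =>
      Finset.sum_congr rfl fun V hV => by rw [cubeChar_flip (hnot V hV)]
    -- Flipping coordinate `a` preserves the uniform measure and negates only the `R` term, so the
    -- moment can be averaged over both signs before the two-point inequality is applied.
    have hsymm : ∑ x : ι → ZMod 2, (P x + bitSign (x a) * R x) ^ (2 * q) =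
        ∑ x : ι → ZMod 2, (P x - bitSign (x a) * R x) ^ (2 * q) := by
      refine Fintype.sum_equiv (Equiv.addRight (Pi.single a 1)) _ _ fun x => ?_
      have : bitSign ((x + Pi.single a 1 : ι → ZMod 2) a) = - bitSign (x a) := by
        rw [Pi.add_apply, bitSign_add, Pi.single_eq_same]
        simp [bitSign]
      rw [Equiv.coe_addRight, hflipP, hflipR, this]
      ring_nf
    have hpt : ∀ x, (P x + bitSign (x a) * R x) ^ (2 * q) + (P x - bitSign (x a) * R x) ^ (2 * q) ≤
        2 * (P x ^ 2 + 2 * q * R x ^ 2) ^ q := by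
      intro x
      have := two_point_inequality (P x) (bitSign (x a) * R x) q
      rwa [mul_pow (bitSign (x a)), sq (bitSign (x a)), bitSign_mul_self, one_mul] at this
    have hsum := Finset.sum_le_sum fun x (_ : x ∈ Finset.univ) => hpt x
    rw [Finset.sum_add_distrib, ← hsymm, ← Finset.mul_sum] at hsum
    simp only [hsplit]
    refine le_trans (by linarith) (?_ : ∑ x, (P x ^ 2 + 2 * q * R x ^ 2) ^ q ≤ _)
    have hcard : ∀ V ∈ s.powerset, (insert a V).card = V.card + 1 := fun V hV =>
      Finset.card_insert_of_notMem (hnot V hV)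
    rw [Finset.sum_powerset_insert ha]
    refine sum_add_pow_le _ _ _ (fun x _ => by positivity) (fun x _ => by positivity)
      (Finset.sum_nonneg fun _ _ => by positivity) (Finset.sum_nonneg fun _ _ => by positivity)
      (by positivity) hq ?_ ?_
    · simpa only [← pow_mul] using ih c
    · have h := ih fun V => c (insert a V)
      have e : ∑ V ∈ s.powerset, (2 * q : ℝ) ^ (insert a V).card * c (insert a V) ^ 2 =
          2 * q * ∑ V ∈ s.powerset, (2 * q : ℝ) ^ V.card * c (insert a V) ^ 2 := by
        rw [Finset.mul_sum]
        refine Finset.sum_congr rfl fun V hV => ?_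
        rw [hcard V hV]
        ring
      rw [e, mul_pow]
      calc ∑ x, (2 * q * R x ^ 2) ^ q = (2 * q : ℝ) ^ q * ∑ x, R x ^ (2 * q) := by
            rw [Finset.mul_sum]
            refine Finset.sum_congr rfl fun x _ => ?_
            rw [mul_pow, ← pow_mul]
        _ ≤ (2 * q : ℝ) ^ q * (Fintype.card (ι → ZMod 2) *
              (∑ V ∈ s.powerset, (2 * q : ℝ) ^ V.card * c (insert a V) ^ 2) ^ q) := by gcongr
        _ = _ := by ring

/-- Bonami's inequality for homogeneous polynomials. -/
theorem sum_pow_homogeneous_le {q : ℕ} (hq : 1 ≤ q) (l : ℕ) (c : Finset ι → ℝ) :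
    ∑ x : ι → ZMod 2, (∑ V ∈ Finset.powersetCard l Finset.univ, c V * cubeChar V x) ^ (2 * q) ≤
      Fintype.card (ι → ZMod 2) *
        ((2 * q : ℝ) ^ l * ∑ V ∈ Finset.powersetCard l (Finset.univ : Finset ι), c V ^ 2) ^ q := by
  have h := sum_pow_cubePolynomial_le hq Finset.univ fun V : Finset ι => if V.card = l then c V else 0
  have e1 : ∀ g : Finset ι → ℝ, ∑ V ∈ (Finset.univ : Finset ι).powerset,
      (if V.card = l then g V else (0 : ℝ)) = ∑ V ∈ Finset.powersetCard l Finset.univ, g V := by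
    intro g
    rw [← Finset.sum_filter, Finset.powersetCard_eq_filter]
  have e2 : ∀ x : ι → ZMod 2, ∑ V ∈ (Finset.univ : Finset ι).powerset,
      (if V.card = l then c V else 0) * cubeChar V x =
        ∑ V ∈ Finset.powersetCard l Finset.univ, c V * cubeChar V x := by
    intro x
    rw [← e1]
    exact Finset.sum_congr rfl fun V _ => by split_ifs <;> simp
  have e3 : ∑ V ∈ (Finset.univ : Finset ι).powerset,
      (2 * q : ℝ) ^ V.card * (if V.card = l then c V else 0) ^ 2 =
        (2 * q : ℝ) ^ l * ∑ V ∈ Finset.powersetCard l Finset.univ, c V ^ 2 := by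
    rw [Finset.mul_sum, ← e1]
    refine Finset.sum_congr rfl fun V _ => ?_
    split_ifs with hV
    · rw [hV]
    · simp
  simpa only [e2, e3] using h

/-- The weight at level `l` of the indicator function of `A`, unnormalized. -/
def levelWeight (A : Finset (ι → ZMod 2)) (l : ℕ) : ℝ :=
  ∑ V ∈ Finset.powersetCard l Finset.univ, (∑ x ∈ A, cubeChar V x) ^ 2

theorem levelWeight_nonneg (A : Finset (ι → ZMod 2)) (l : ℕ) : 0 ≤ levelWeight A l :=
  Finset.sum_nonneg fun _ _ => sq_nonneg _

/-- A level inequality for a partition of the cube. -/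
theorem sum_sqrt_levelWeight_pow_le {Z : Type*} [Fintype Z] [DecidableEq Z]
    (msg : (ι → ZMod 2) → Z) {q : ℕ} (hq : 1 ≤ q) (l : ℕ) :
    (∑ z, √(levelWeight {x | msg x = z} l)) ^ (2 * q) ≤
      (Fintype.card (ι → ZMod 2) : ℝ) ^ (2 * q) * (Fintype.card Z * ((2 * q : ℝ) ^ l) ^ q) := by
  -- The level-`l` Fourier part of each class is normalized to norm at most one, so that `g z` sums
  -- over the class to the square root of its weight. If the weight is zero, division by zero makes
  -- `g z` vanish, which is harmless.
  set c : Z → Finset ι → ℝ := fun z V =>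
    (∑ x with msg x = z, cubeChar V x) / √(levelWeight {x | msg x = z} l) with hc
  set g : Z → (ι → ZMod 2) → ℝ := fun z x =>
    ∑ V ∈ Finset.powersetCard l Finset.univ, c z V * cubeChar V x with hg
  set Q : ℝ := (Fintype.card (ι → ZMod 2) : ℝ) with hQ
  have hQ0 : 0 < Q := by positivity
  have hsum : ∑ z, √(levelWeight {x | msg x = z} l) = ∑ x, g (msg x) x := by
    rw [← Finset.sum_fiberwise (s := Finset.univ) (g := msg)]
    refine Finset.sum_congr rfl fun z _ => ?_
    have : ∑ x with msg x = z, g (msg x) x = ∑ x with msg x = z, g z x :=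
      Finset.sum_congr rfl fun x hx => by rw [(Finset.mem_filter.1 hx).2]
    rw [this, hg, Finset.sum_comm]
    simp only [← Finset.mul_sum, hc, div_mul_eq_mul_div, ← sq, ← Finset.sum_div]
    exact (Real.div_sqrt).symm
  have hnorm : ∀ z, ∑ V ∈ Finset.powersetCard l (Finset.univ : Finset ι), c z V ^ 2 ≤ 1 := by
    intro z
    simp only [hc, div_pow, ← Finset.sum_div]
    rw [Real.sq_sqrt (levelWeight_nonneg _ _)]
    exact div_self_le_one _
  have hz : ∀ z, ∑ x, g z x ^ (2 * q) ≤ Q * ((2 * q : ℝ) ^ l) ^ q := by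
    intro z
    refine (sum_pow_homogeneous_le hq l (c z)).trans ?_
    refine mul_le_mul_of_nonneg_left (pow_le_pow_left₀ ?_ ?_ q) hQ0.le
    · exact mul_nonneg (by positivity) (Finset.sum_nonneg fun _ _ => sq_nonneg _)
    · exact mul_le_of_le_one_right (by positivity) (hnorm z)
  have hmean : (∑ x, |g (msg x) x|) ^ (2 * q) ≤
      Q ^ (2 * q - 1) * ∑ x, g (msg x) x ^ (2 * q) := by
    have := pow_sum_div_card_le_sum_pow (s := Finset.univ) (f := fun x => |g (msg x) x|)
      (fun _ _ => abs_nonneg _) (2 * q - 1)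
    rw [Nat.sub_add_cancel (by omega), Finset.card_univ, ← hQ, div_le_iff₀ (by positivity)] at this
    refine this.trans (le_of_eq ?_)
    rw [mul_comm]
    congr 1
    exact Finset.sum_congr rfl fun x _ => Even.pow_abs ⟨q, by ring⟩ _
  -- The union bound over messages: its cost, the factor `|Z|`, shrinks to `|Z| ^ (1 / (2 q))` once
  -- roots are taken.
  have hle : ∑ x, g (msg x) x ^ (2 * q) ≤ ∑ z, ∑ x, g z x ^ (2 * q) := by
    rw [Finset.sum_comm]
    refine Finset.sum_le_sum fun x _ => ?_
    exact Finset.single_le_sum (f := fun z => g z x ^ (2 * q))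
      (fun z _ => Even.pow_nonneg ⟨q, by ring⟩ _) (Finset.mem_univ (msg x))
  rw [hsum]
  calc (∑ x, g (msg x) x) ^ (2 * q) = |∑ x, g (msg x) x| ^ (2 * q) :=
        (Even.pow_abs ⟨q, by ring⟩ _).symm
    _ ≤ (∑ x, |g (msg x) x|) ^ (2 * q) := by
        gcongr
        exact Finset.abs_sum_le_sum_abs _ _
    _ ≤ Q ^ (2 * q - 1) * ∑ z : Z, Q * ((2 * q : ℝ) ^ l) ^ q := by
        refine hmean.trans ?_
        gcongr
        exact hle.trans (Finset.sum_le_sum fun z _ => hz z)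
    _ = _ := by
        rw [Finset.sum_const, Finset.card_univ, nsmul_eq_mul]
        have : Q ^ (2 * q) = Q ^ (2 * q - 1) * Q := by
          rw [← pow_succ, Nat.sub_add_cancel (by omega)]
        rw [this]
        ring

/-- For `S ≤ q * l` the number of messages is at most `(2 ^ l) ^ q`, which only turns `2 q` into `4
q`. -/
theorem sum_sqrt_levelWeight_le {Z : Type*} [Fintype Z] [DecidableEq Z]
    (msg : (ι → ZMod 2) → Z) {q l S : ℕ} (hq : 1 ≤ q) (hZ : Fintype.card Z = 2 ^ S)
    (hS : S ≤ q * l) :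
    ∑ z, √(levelWeight {x | msg x = z} l) ≤
      Fintype.card (ι → ZMod 2) * √((4 * q : ℝ) ^ l) := by
  have h := sum_sqrt_levelWeight_pow_le msg hq l
  have hZ' : (Fintype.card Z : ℝ) ≤ (2 ^ l) ^ q := by
    rw [hZ, ← pow_mul, mul_comm]
    exact_mod_cast Nat.pow_le_pow_right (by norm_num) hS
  refine le_of_sq_le_sq ?_ (by positivity)
  rw [mul_pow, Real.sq_sqrt (by positivity)]
  refine le_of_pow_le_pow_left₀ (n := q) (by omega) ?_ ?_
  · positivity
  rw [← pow_mul]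
  refine h.trans ?_
  rw [mul_pow _ _ q, ← pow_mul (Fintype.card (ι → ZMod 2) : ℝ)]
  refine mul_le_mul_of_nonneg_left ?_ (by positivity)
  calc (Fintype.card Z : ℝ) * ((2 * q : ℝ) ^ l) ^ q ≤ (2 ^ l) ^ q * ((2 * q : ℝ) ^ l) ^ q :=
        mul_le_mul_of_nonneg_right hZ' (by positivity)
    _ = _ := by
      rw [← mul_pow, ← mul_pow]
      ring

end Cube

/-! ### Parities over a random hypermatching -/

section Fourier

set_option linter.unusedSectionVars false

variable {κ : Type*} [Fintype κ] [DecidableEq κ]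

theorem sum_cubeChar_mul_cubeChar (x y : κ → ZMod 2) :
    ∑ J : Finset κ, cubeChar J x * cubeChar J y = if x = y then 2 ^ Fintype.card κ else 0 := by
  have h : ∑ J : Finset κ, cubeChar J x * cubeChar J y =
      ∏ i, (1 + bitSign (x i) * bitSign (y i)) := by
    rw [Finset.prod_one_add, Finset.powerset_univ]
    exact Finset.sum_congr rfl fun J _ => Finset.prod_mul_distrib.symm
  rw [h]
  split_ifs with hxy
  · subst hxy
    simp only [bitSign_mul_self]
    norm_num
  · obtain ⟨i, hi⟩ := Function.ne_iff.1 hxy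
    refine Finset.prod_eq_zero (Finset.mem_univ i) ?_
    have key : ∀ a b : ZMod 2, a ≠ b → a = 0 ∧ b = 1 ∨ a = 1 ∧ b = 0 := by decide
    rcases key _ _ hi with ⟨h1, h2⟩ | ⟨h1, h2⟩ <;> rw [h1, h2] <;> simp [bitSign]

theorem sum_cubeChar_transform_mul (h : (κ → ZMod 2) → ℝ) (y : κ → ZMod 2) :
    ∑ J : Finset κ, (∑ w, h w * cubeChar J w) * cubeChar J y = 2 ^ Fintype.card κ * h y := by
  simp only [Finset.sum_mul]
  rw [Finset.sum_comm]
  simp only [mul_assoc, ← Finset.mul_sum, sum_cubeChar_mul_cubeChar]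
  simp [mul_comm]

theorem sum_cubeChar_transform_sq (h : (κ → ZMod 2) → ℝ) :
    ∑ J : Finset κ, (∑ w, h w * cubeChar J w) ^ 2 = 2 ^ Fintype.card κ * ∑ w, h w ^ 2 := by
  have e : ∀ J : Finset κ, (∑ w, h w * cubeChar J w) ^ 2 =
      ∑ y, h y * ((∑ w, h w * cubeChar J w) * cubeChar J y) := by
    intro J
    rw [sq, Finset.mul_sum]
    exact Finset.sum_congr rfl fun y _ => by ring
  simp only [e]
  rw [Finset.sum_comm, Finset.mul_sum]
  refine Finset.sum_congr rfl fun y _ => ?_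
  rw [← Finset.mul_sum, sum_cubeChar_transform_mul]
  ring

/-- Expand `h` in characters. Mean zero removes the empty frequency; Cauchy–Schwarz separates the
coefficients of `h`, which Parseval and `|h| ≤ 1` control, from the character sums over `A`. -/
theorem abs_sum_comp_le_sqrt {X : Type*} (A : Finset X) (M : X → κ → ZMod 2)
    (h : (κ → ZMod 2) → ℝ) (h1 : ∀ w, |h w| ≤ 1) (h0 : ∑ w, h w = 0) :
    |∑ x ∈ A, h (M x)| ≤
      √(∑ J ∈ (Finset.univ : Finset (Finset κ)).erase ∅, (∑ x ∈ A, cubeChar J (M x)) ^ 2) := by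
  set T : Finset κ → ℝ := fun J => ∑ w, h w * cubeChar J w with hT
  set K : ℝ := 2 ^ Fintype.card κ with hK
  have hK0 : 0 < K := by positivity
  have hT0 : T ∅ = 0 := by simpa [hT, cubeChar] using h0
  have hT2 : ∑ J ∈ (Finset.univ : Finset (Finset κ)).erase ∅, T J ^ 2 ≤ K ^ 2 := by
    calc ∑ J ∈ (Finset.univ : Finset (Finset κ)).erase ∅, T J ^ 2 ≤ ∑ J, T J ^ 2 :=
          Finset.sum_le_sum_of_subset_of_nonneg (Finset.erase_subset _ _)
            fun _ _ _ => sq_nonneg _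
      _ = K * ∑ w, h w ^ 2 := sum_cubeChar_transform_sq h
      _ ≤ K * ∑ w : κ → ZMod 2, 1 := by
          refine mul_le_mul_of_nonneg_left (Finset.sum_le_sum fun w _ => ?_) hK0.le
          rw [← sq_abs]
          exact pow_le_one₀ (abs_nonneg _) (h1 w)
      _ = K ^ 2 := by simp [hK, sq]
  have hexp : K * ∑ x ∈ A, h (M x) =
      ∑ J ∈ (Finset.univ : Finset (Finset κ)).erase ∅, T J * ∑ x ∈ A, cubeChar J (M x) := by
    rw [Finset.sum_erase _ (by rw [hT0, zero_mul])]
    simp only [Finset.mul_sum]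
    rw [Finset.sum_comm]
    exact Finset.sum_congr rfl fun x _ => (sum_cubeChar_transform_mul h (M x)).symm
  refine Real.abs_le_sqrt ?_
  have hcs := Finset.sum_mul_sq_le_sq_mul_sq ((Finset.univ : Finset (Finset κ)).erase ∅) T
    fun J => ∑ x ∈ A, cubeChar J (M x)
  rw [← hexp, mul_pow] at hcs
  refine le_of_mul_le_mul_left (hcs.trans ?_) (pow_pos hK0 2)
  exact mul_le_mul_of_nonneg_right hT2 (Finset.sum_nonneg fun _ _ => sq_nonneg _)

end Fourier

/-! ### Averaging over the random position of the hyperedges -/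

section Perm

variable {ι : Type*} [Fintype ι] [DecidableEq ι]

theorem exists_perm_map_eq (U V : Finset ι) (h : U.card = V.card) :
    ∃ σ : Equiv.Perm ι, U.map σ.toEmbedding = V := by
  have e : {x // x ∈ U} ≃ {x // x ∈ V} := Finset.equivOfCardEq h
  refine ⟨e.extendSubtype, ?_⟩
  refine Finset.eq_of_subset_of_card_le (fun y hy => ?_) (by simp [h])
  obtain ⟨x, hx, rfl⟩ := Finset.mem_map.1 hy
  exact e.extendSubtype_mem x hx

/-- A random permutation carries `U` to a uniformly random set of its size. Double counting: the sum
over permutations depends only on the size of `U`, and for a fixed permutation the sum over all sets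
of that size is unchanged. -/
theorem sum_perm_map (U : Finset ι) (g : Finset ι → ℝ) :
    ((Fintype.card ι).choose U.card : ℝ) * ∑ σ : Equiv.Perm ι, g (U.map σ.toEmbedding) =
      Fintype.card (Equiv.Perm ι) * ∑ V ∈ Finset.powersetCard U.card Finset.univ, g V := by
  have h1 : ∀ V ∈ Finset.powersetCard U.card (Finset.univ : Finset ι),
      ∑ σ : Equiv.Perm ι, g (V.map σ.toEmbedding) = ∑ σ : Equiv.Perm ι, g (U.map σ.toEmbedding) := by
    intro V hV
    obtain ⟨τ, rfl⟩ := exists_perm_map_eq U V (Finset.mem_powersetCard.1 hV).2.symm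
    refine Fintype.sum_equiv (Equiv.mulRight τ) _ _ fun σ => ?_
    rw [Finset.map_map]
    rfl
  have h2 : ∀ σ : Equiv.Perm ι, ∑ V ∈ Finset.powersetCard U.card (Finset.univ : Finset ι),
      g (V.map σ.toEmbedding) = ∑ V ∈ Finset.powersetCard U.card Finset.univ, g V := by
    intro σ
    conv_rhs => rw [← Finset.map_univ_equiv σ, Finset.powersetCard_map, Finset.sum_map]
    rfl
  have h3 := Finset.sum_congr rfl h1
  rw [Finset.sum_comm, Finset.sum_congr rfl fun σ _ => h2 σ] at h3
  simp only [Finset.sum_const, Finset.card_powersetCard, Finset.card_univ, nsmul_eq_mul] at h3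
  exact h3.symm

end Perm

theorem sqrt_sum_le_sum_sqrt {α : Type*} (s : Finset α) (g : α → ℝ) (hg : ∀ i ∈ s, 0 ≤ g i) :
    √(∑ i ∈ s, g i) ≤ ∑ i ∈ s, √(g i) := by
  refine Real.sqrt_le_iff.2 ⟨Finset.sum_nonneg fun _ _ => Real.sqrt_nonneg _, ?_⟩
  calc ∑ i ∈ s, g i = ∑ i ∈ s, √(g i) ^ 2 :=
        Finset.sum_congr rfl fun i hi => (Real.sq_sqrt (hg i hi)).symm
    _ ≤ _ := Finset.sum_sq_le_sq_sum_of_nonneg fun _ _ => Real.sqrt_nonneg _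

theorem sum_sqrt_le_sqrt_card_mul_sum {α : Type*} [Fintype α] (g : α → ℝ) (hg : ∀ i, 0 ≤ g i) :
    ∑ i, √(g i) ≤ √(Fintype.card α * ∑ i, g i) := by
  refine Real.le_sqrt_of_sq_le ?_
  have h := sq_sum_le_card_mul_sum_sq (s := Finset.univ) (f := fun i => √(g i))
  simpa only [Real.sq_sqrt (hg _), Finset.card_univ] using h

/-- The parities of the bits of `x` over the hyperedges `π ({j} × Fin t)`. -/
def edgeParity {r t u : ℕ} (π : Equiv.Perm ((Fin r × Fin t) ⊕ Fin u))
    (x : (Fin r × Fin t) ⊕ Fin u → ZMod 2) (j : Fin r) : ZMod 2 :=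
  ∑ s, x (π (Sum.inl (j, s)))

/-- The positions which belong to the hyperedges in `J`. -/
def edgeUnion {r t : ℕ} (u : ℕ) (J : Finset (Fin r)) : Finset ((Fin r × Fin t) ⊕ Fin u) :=
  (J ×ˢ Finset.univ).map Function.Embedding.inl

theorem card_edgeUnion {r t : ℕ} (u : ℕ) (J : Finset (Fin r)) :
    (edgeUnion u J : Finset ((Fin r × Fin t) ⊕ Fin u)).card = J.card * t := by
  simp [edgeUnion]

theorem cubeChar_edgeParity {r t u : ℕ} (π : Equiv.Perm ((Fin r × Fin t) ⊕ Fin u))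
    (x : (Fin r × Fin t) ⊕ Fin u → ZMod 2) (J : Finset (Fin r)) :
    cubeChar J (edgeParity π x) = cubeChar ((edgeUnion u J).map π.toEmbedding) x := by
  simp only [cubeChar, edgeParity, edgeUnion, bitSign_sum, Finset.prod_map, Finset.prod_product]
  rfl

/-- The Fourier-analytic bound for the contribution of `k` hyperedges to the advantage. -/
noncomputable def levelBound (n S t r k : ℕ) : ℝ :=
  √(r.choose k / n.choose (k * t) * (4 * (S / (k * t) + 1 : ℕ) : ℝ) ^ (k * t))

section Advantage

variable {r t u S : ℕ} {Z : Type*} [Fintype Z] [DecidableEq Z]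

/-- Group the `J` by their size `k`. Each of the `r.choose k` unions becomes a uniformly random `k *
t`-set, with average squared character sum the level weight over `(r * t + u).choose (k * t)`. The
roots are handled by subadditivity over `k` and concavity over `π`. -/
theorem sum_perm_sqrt_le (A : Finset ((Fin r × Fin t) ⊕ Fin u → ZMod 2)) :
    ∑ π : Equiv.Perm ((Fin r × Fin t) ⊕ Fin u),
      √(∑ J ∈ (Finset.univ : Finset (Finset (Fin r))).erase ∅,
        (∑ x ∈ A, cubeChar J (edgeParity π x)) ^ 2) ≤
      Fintype.card (Equiv.Perm ((Fin r × Fin t) ⊕ Fin u)) * ∑ k ∈ Finset.Icc 1 r,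
        √(r.choose k / (r * t + u).choose (k * t) * levelWeight A (k * t)) := by
  set P : ℝ := (Fintype.card (Equiv.Perm ((Fin r × Fin t) ⊕ Fin u)) : ℝ) with hP
  set G : Equiv.Perm ((Fin r × Fin t) ⊕ Fin u) → Finset (Fin r) → ℝ := fun π J =>
    (∑ x ∈ A, cubeChar J (edgeParity π x)) ^ 2 with hG
  have hG0 : ∀ π J, 0 ≤ G π J := fun _ _ => sq_nonneg _
  have hsplit : ∀ π, ∑ J ∈ (Finset.univ : Finset (Finset (Fin r))).erase ∅, G π J =
      ∑ k ∈ Finset.Icc 1 r, ∑ J ∈ Finset.powersetCard k Finset.univ, G π J := by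
    intro π
    rw [← Finset.sum_fiberwise_of_maps_to (t := Finset.Icc 1 r) (g := Finset.card)]
    · refine Finset.sum_congr rfl fun k hk => Finset.sum_congr ?_ fun _ _ => rfl
      ext J
      have := (Finset.mem_Icc.1 hk).1
      simp only [Finset.mem_filter, Finset.mem_erase, Finset.mem_univ, and_true,
        Finset.mem_powersetCard, Finset.subset_univ, true_and, and_iff_right_iff_imp]
      rintro h rfl
      simp at h
      omega
    · intro J hJ
      refine Finset.mem_Icc.2 ⟨?_, ?_⟩
      · exact Finset.card_pos.2 (Finset.nonempty_iff_ne_empty.2 (Finset.mem_erase.1 hJ).1)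
      · simpa using Finset.card_le_univ J
  have hlevel : ∀ k ∈ Finset.Icc 1 r, ∑ π, ∑ J ∈ Finset.powersetCard k Finset.univ, G π J =
      P * (r.choose k / (r * t + u).choose (k * t) * levelWeight A (k * t)) := by
    intro k hk
    have hkr := (Finset.mem_Icc.1 hk).2
    have hpos : 0 < ((r * t + u).choose (k * t) : ℝ) := by
      exact_mod_cast Nat.choose_pos ((Nat.mul_le_mul_right t hkr).trans (Nat.le_add_right _ _))
    rw [Finset.sum_comm]
    have : ∀ J ∈ Finset.powersetCard k (Finset.univ : Finset (Fin r)), ∑ π, G π J =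
        P * levelWeight A (k * t) / (r * t + u).choose (k * t) := by
      intro J hJ
      rw [eq_div_iff hpos.ne', mul_comm]
      have := sum_perm_map (edgeUnion u J : Finset ((Fin r × Fin t) ⊕ Fin u))
        fun V => (∑ x ∈ A, cubeChar V x) ^ 2
      rw [card_edgeUnion, (Finset.mem_powersetCard.1 hJ).2] at this
      simpa [hG, cubeChar_edgeParity, levelWeight] using this
    rw [Finset.sum_congr rfl this, Finset.sum_const, Finset.card_powersetCard, nsmul_eq_mul]
    simp
    ring
  calc _ ≤ ∑ π, ∑ k ∈ Finset.Icc 1 r, √(∑ J ∈ Finset.powersetCard k Finset.univ, G π J) := by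
        refine Finset.sum_le_sum fun π _ => ?_
        refine (Real.sqrt_le_sqrt (hsplit π).le).trans ?_
        exact sqrt_sum_le_sum_sqrt _ _ fun _ _ => Finset.sum_nonneg fun _ _ => hG0 _ _
    _ = ∑ k ∈ Finset.Icc 1 r, ∑ π, √(∑ J ∈ Finset.powersetCard k Finset.univ, G π J) :=
        Finset.sum_comm
    _ ≤ ∑ k ∈ Finset.Icc 1 r,
          √(P * (P * (r.choose k / (r * t + u).choose (k * t) * levelWeight A (k * t)))) := by
        refine Finset.sum_le_sum fun k hk => ?_
        rw [← hlevel k hk]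
        exact sum_sqrt_le_sqrt_card_mul_sum _ fun _ => Finset.sum_nonneg fun _ _ => hG0 _ _
    _ = _ := by
        rw [Finset.mul_sum]
        refine Finset.sum_congr rfl fun k _ => ?_
        rw [← mul_assoc, Real.sqrt_mul (by positivity), Real.sqrt_mul_self (by positivity)]

/-- A one-way message of `S` bits about `x` hardly helps to tell the parities of `x` over a random
hypermatching from their complements. -/
theorem sum_parity_advantage_le (ht : 1 ≤ t) (hZ : Fintype.card Z = 2 ^ S)
    (msg : ((Fin r × Fin t) ⊕ Fin u → ZMod 2) → Z)
    (G : Equiv.Perm ((Fin r × Fin t) ⊕ Fin u) → Z → (Fin r → ZMod 2) → ℝ)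
    (hG0 : ∀ π z w, 0 ≤ G π z w) (hG1 : ∀ π z w, G π z w ≤ 1) :
    ∑ π, ∑ x, (G π (msg x) (edgeParity π x) - G π (msg x) (edgeParity π x + 1)) ≤
      Fintype.card (Equiv.Perm ((Fin r × Fin t) ⊕ Fin u)) *
        Fintype.card ((Fin r × Fin t) ⊕ Fin u → ZMod 2) *
          ∑ k ∈ Finset.Icc 1 r, levelBound (r * t + u) S t r k := by
  set P : ℝ := (Fintype.card (Equiv.Perm ((Fin r × Fin t) ⊕ Fin u)) : ℝ) with hP
  set Q : ℝ := (Fintype.card ((Fin r × Fin t) ⊕ Fin u → ZMod 2) : ℝ) with hQ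
  have hone : ∀ π z, ∑ x with msg x = z, (G π z (edgeParity π x) - G π z (edgeParity π x + 1)) ≤
      √(∑ J ∈ (Finset.univ : Finset (Finset (Fin r))).erase ∅,
        (∑ x with msg x = z, cubeChar J (edgeParity π x)) ^ 2) := by
    intro π z
    refine (le_abs_self _).trans (abs_sum_comp_le_sqrt _ (edgeParity π)
      (fun w => G π z w - G π z (w + 1)) (fun w => ?_) ?_)
    · rw [abs_le]
      constructor <;> linarith [hG0 π z w, hG1 π z w, hG0 π z (w + 1), hG1 π z (w + 1)]
    · rw [Finset.sum_sub_distrib, sub_eq_zero]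
      exact (Fintype.sum_equiv (Equiv.addRight 1) _ _ fun w => rfl).symm
  calc _ = ∑ π, ∑ z, ∑ x with msg x = z,
          (G π z (edgeParity π x) - G π z (edgeParity π x + 1)) := by
        refine Finset.sum_congr rfl fun π _ => ?_
        rw [← Finset.sum_fiberwise (s := Finset.univ) (g := msg)]
        refine Finset.sum_congr rfl fun z _ => Finset.sum_congr rfl fun x hx => ?_
        rw [(Finset.mem_filter.1 hx).2]
    _ ≤ ∑ π, ∑ z, √(∑ J ∈ (Finset.univ : Finset (Finset (Fin r))).erase ∅,
        (∑ x with msg x = z, cubeChar J (edgeParity π x)) ^ 2) :=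
        Finset.sum_le_sum fun π _ => Finset.sum_le_sum fun z _ => hone π z
    _ = ∑ z, ∑ π, √(∑ J ∈ (Finset.univ : Finset (Finset (Fin r))).erase ∅,
        (∑ x with msg x = z, cubeChar J (edgeParity π x)) ^ 2) := Finset.sum_comm
    _ ≤ ∑ z, P * ∑ k ∈ Finset.Icc 1 r, √(r.choose k / (r * t + u).choose (k * t) *
          levelWeight {x | msg x = z} (k * t)) :=
        Finset.sum_le_sum fun z _ => sum_perm_sqrt_le _
    _ = P * ∑ k ∈ Finset.Icc 1 r, √(r.choose k / (r * t + u).choose (k * t)) *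
          ∑ z, √(levelWeight {x | msg x = z} (k * t)) := by
        rw [← Finset.mul_sum, Finset.sum_comm]
        congr 1
        refine Finset.sum_congr rfl fun k _ => ?_
        rw [Finset.mul_sum]
        exact Finset.sum_congr rfl fun z _ => Real.sqrt_mul (by positivity) _
    _ ≤ P * ∑ k ∈ Finset.Icc 1 r, Q * levelBound (r * t + u) S t r k := by
        refine mul_le_mul_of_nonneg_left (Finset.sum_le_sum fun k hk => ?_) (by positivity)
        have hkt : 0 < k * t := Nat.mul_pos (Finset.mem_Icc.1 hk).1 ht
        -- With the rounded-down quotient plus one as exponent, `q ≥ 1` and `S ≤ q * (k * t)` hold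
        -- even when `S < k * t`.
        have h := sum_sqrt_levelWeight_le msg (q := S / (k * t) + 1) (l := k * t)
          (Nat.le_add_left _ _) hZ (by
            rw [mul_comm]
            exact (Nat.lt_mul_div_succ S hkt).le)
        refine (mul_le_mul_of_nonneg_left h (Real.sqrt_nonneg _)).trans (le_of_eq ?_)
        rw [levelBound, Real.sqrt_mul (by positivity)]
        ring
    _ = _ := by rw [← Finset.mul_sum, mul_assoc]

end Advantage

/-! ### Smallness of the advantage -/

theorem choose_le_three_mul_div_pow {r k : ℕ} (hk : 1 ≤ k) :
    (r.choose k : ℝ) ≤ (3 * r / k) ^ k := by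
  have hk0 : (0 : ℝ) < k := by exact_mod_cast hk
  have h1 : (k : ℝ) ^ k / k.factorial ≤ 3 ^ k := by
    refine (Real.pow_div_factorial_le_exp (x := (k : ℝ)) hk0.le k).trans ?_
    rw [← mul_one (k : ℝ), Real.exp_nat_mul]
    gcongr
    exact (Real.exp_one_lt_d9.trans (by norm_num)).le
  have hf : (0 : ℝ) < k.factorial := by exact_mod_cast k.factorial_pos
  calc (r.choose k : ℝ) ≤ r ^ k / k.factorial := Nat.choose_le_pow_div k r
    _ = (r / k) ^ k * (k ^ k / k.factorial) := by
        rw [div_pow]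
        field_simp
    _ ≤ (r / k) ^ k * 3 ^ k := by gcongr
    _ = _ := by
        rw [← mul_pow]
        ring

theorem div_two_mul_pow_le_choose {n l : ℕ} (hl : 1 ≤ l) (hn : 2 * l ≤ n) :
    ((n : ℝ) / (2 * l)) ^ l ≤ n.choose l := by
  have hl0 : (0 : ℝ) < l := by exact_mod_cast hl
  have hf : (0 : ℝ) < l.factorial := by exact_mod_cast l.factorial_pos
  have hn' : (2 * l : ℝ) ≤ n := by exact_mod_cast hn
  refine le_trans ?_ (Nat.pow_le_choose l n)
  rw [div_mul_eq_div_div, div_pow]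
  have h1 : (n : ℝ) / 2 ≤ (n + 1 - l : ℕ) := by
    rw [Nat.cast_sub (by omega)]
    push_cast
    linarith
  have h2 : (l.factorial : ℝ) ≤ l ^ l := by exact_mod_cast Nat.factorial_le_pow l
  gcongr

/-- Two regimes. For `k * t ≤ s` the message length dominates and `h1` gives a geometric series. For
larger `k` the message is negligible and sparsity of the hyperedges, `n = 768 r t`, gives the decay.
-/
theorem levelBound_le {r t S k n : ℕ} (hn : n = 768 * (r * t)) (ht : 1 ≤ t) (hk : 1 ≤ k)
    (hkr : k ≤ r) {s θ : ℝ} (hS : S ≤ s) (hθ0 : 0 ≤ θ) (hθ1 : θ ≤ 1)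
    (h1 : 4 * (r * (16 * s / n) ^ t) ≤ θ ^ 2) (h2 : s < k * t → (1 / 2 : ℝ) ^ k ≤ θ) :
    levelBound n S t r k ≤ (1 / 2) ^ k * θ := by
  have hk0 : (0 : ℝ) < k := by exact_mod_cast hk
  have ht0 : (0 : ℝ) < t := by exact_mod_cast ht
  have hr0 : (0 : ℝ) < r := by exact_mod_cast hk.trans hkr
  have hkr' : (k : ℝ) ≤ r := by exact_mod_cast hkr
  have hkt : 1 ≤ k * t := Nat.mul_pos hk ht
  have hktn : k * t ≤ r * t := Nat.mul_le_mul_right t hkr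
  have hn' : (n : ℝ) = 768 * (r * t) := by exact_mod_cast hn
  have hn0 : (0 : ℝ) < n := by rw [hn']; positivity
  set l := k * t with hl
  have hlR : (l : ℝ) = k * t := by rw [hl]; push_cast; ring
  have hl0 : (0 : ℝ) < l := by exact_mod_cast hkt
  have hch := div_two_mul_pow_le_choose hkt (n := n) (by omega)
  have hdiv : ((S / l + 1 : ℕ) : ℝ) * l ≤ S + l := by
    have := Nat.div_mul_le_self S l
    have h : (S / l + 1) * l ≤ S + l := by
      rw [add_mul, one_mul]
      omega
    exact_mod_cast h
  have hY : r.choose k / n.choose l * (4 * (S / l + 1 : ℕ) : ℝ) ^ l ≤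
      r.choose k * (8 * (S + l) / n) ^ l := by
    calc r.choose k / n.choose l * (4 * (S / l + 1 : ℕ) : ℝ) ^ l
        ≤ r.choose k / ((n : ℝ) / (2 * l)) ^ l * (4 * (S / l + 1 : ℕ) : ℝ) ^ l := by gcongr
      _ = r.choose k * (8 * (((S / l + 1 : ℕ) : ℝ) * l) / n) ^ l := by
          rw [div_mul_eq_mul_div, mul_div_assoc, ← div_pow]
          congr 2
          field_simp
          ring
      _ ≤ _ := by gcongr
  rw [levelBound, ← hl]
  refine Real.sqrt_le_iff.2 ⟨by positivity, hY.trans ?_⟩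
  have e4 : ((1 / 2 : ℝ) ^ k * θ) ^ 2 = (1 / 4) ^ k * θ ^ 2 := by
    rw [mul_pow, ← pow_mul, mul_comm k 2, pow_mul]
    norm_num
  rw [e4]
  rcases le_or_gt (l : ℝ) s with h | h
  · calc r.choose k * (8 * (S + l) / n : ℝ) ^ l ≤ r ^ k * (8 * (2 * s) / n) ^ l := by
          gcongr
          · exact_mod_cast Nat.choose_le_pow r k
          · linarith
      _ = (r * (16 * s / n) ^ t) ^ k := by
          rw [mul_pow, ← pow_mul, hl, mul_comm k t, ← mul_assoc]
          norm_num
      _ ≤ (θ ^ 2 / 4) ^ k := by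
          have : 0 ≤ s := hl0.le.trans h
          gcongr
          linarith
      _ = (1 / 4) ^ k * (θ ^ 2) ^ k := by
          rw [← mul_pow]
          ring
      _ ≤ (1 / 4) ^ k * θ ^ 2 := by
          gcongr
          exact pow_le_of_le_one (by positivity) (pow_le_one₀ hθ0 hθ1) (by omega)
  · have hθ := h2 (hlR ▸ h)
    calc r.choose k * (8 * (S + l) / n : ℝ) ^ l ≤ (3 * r / k) ^ k * (8 * (2 * l) / n) ^ l := by
          gcongr
          · exact choose_le_three_mul_div_pow hk
          · linarith
      -- This is where `768 = 16 * 48` enters: with `k / (48 r) ≤ 1` the exponent drops to `k`, and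
      -- `3 / 48 = 1 / 16` remains.
      _ = (3 * r / k) ^ k * (k / (48 * r)) ^ l := by
          congr 2
          rw [hlR, hn']
          field_simp
          ring
      _ ≤ (3 * r / k) ^ k * (k / (48 * r)) ^ k := by
          refine mul_le_mul_of_nonneg_left ?_ (by positivity)
          refine pow_le_pow_of_le_one (by positivity) ?_ (Nat.le_mul_of_pos_right k ht)
          rw [div_le_one (by positivity)]
          linarith
      _ = (1 / 16) ^ k := by
          rw [← mul_pow]
          congr 1
          field_simp
          norm_num
      _ = (1 / 4) ^ k * ((1 / 2) ^ k) ^ 2 := by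
          rw [← pow_mul, mul_comm k 2, pow_mul, ← mul_pow]
          norm_num
      _ ≤ (1 / 4) ^ k * θ ^ 2 := by gcongr

theorem sum_Icc_half_pow_le (r : ℕ) : ∑ k ∈ Finset.Icc 1 r, (1 / 2 : ℝ) ^ k ≤ 1 := by
  have h : ∑ k ∈ Finset.Icc 1 r, (1 / 2 : ℝ) ^ k = 1 - (1 / 2) ^ r := by
    induction r with
    | zero => simp
    | succ r ih =>
      rw [Finset.sum_Icc_succ_top (by omega), ih]
      ring
  rw [h]
  linarith [pow_pos (by norm_num : (0 : ℝ) < 1 / 2) r]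

theorem exists_sum_levelBound_le {m : ℕ} (hm : 1 ≤ m) {η : ℝ} (hη : 0 < η) :
    ∃ N₀ : ℕ, ∀ N : ℕ, N₀ ≤ N → ∃ r : ℕ, 1 ≤ r ∧ 1536 * (r * (m + 2)) ≤ N ∧
      N ≤ 3072 * (r * (m + 2)) ∧ ∀ S : ℕ, (S : ℝ) < (N : ℝ) ^ (1 - 1 / (m : ℝ)) →
        ∑ k ∈ Finset.Icc 1 r, levelBound (768 * (r * (m + 2))) S (m + 2) r k ≤ η := by
  set t := m + 2 with ht
  set θ := min η 1 with hθ
  have hθ0 : 0 < θ := lt_min hη one_pos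
  have hm0 : (0 : ℝ) < m := by exact_mod_cast hm
  have hm1 : (0 : ℝ) < 1 / ((m : ℝ) + 1) := by positivity
  have hm2 : (0 : ℝ) < 1 - 1 / ((m : ℝ) + 1) := by
    rw [sub_pos, div_lt_one (by positivity)]
    linarith
  obtain ⟨k₀, hk₀⟩ := exists_pow_lt_of_lt_one hθ0 (by norm_num : (1 / 2 : ℝ) < 1)
  have T1 : Tendsto (fun N : ℕ => 4 * 64 ^ t * (N : ℝ) ^ (-(1 / ((m : ℝ) + 1)))) atTop (𝓝 0) := by
    simpa using ((tendsto_rpow_neg_atTop hm1).comp tendsto_natCast_atTop_atTop).const_mul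
      (4 * 64 ^ t : ℝ)
  have T2 : Tendsto (fun N : ℕ => (N : ℝ) ^ (1 - 1 / ((m : ℝ) + 1))) atTop atTop :=
    (tendsto_rpow_atTop hm2).comp tendsto_natCast_atTop_atTop
  obtain ⟨N₀, hN₀⟩ := eventually_atTop.1 ((T1.eventually (gt_mem_nhds (pow_pos hθ0 2))).and
    ((T2.eventually_ge_atTop (t * k₀ : ℝ)).and (eventually_ge_atTop (1536 * t))))
  refine ⟨N₀, fun N hN => ?_⟩
  obtain ⟨hN1, hN2, hN3⟩ := hN₀ N hN
  have htpos : 0 < 1536 * t := by omega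
  set r := N / (1536 * t) with hr
  have hr1 : 1 ≤ r := (Nat.one_le_div_iff htpos).2 hN3
  have hr2 : 1536 * (r * t) ≤ N := by
    have := Nat.div_mul_le_self N (1536 * t)
    rw [← hr] at this
    linarith
  have hr3 : N ≤ 3072 * (r * t) := by
    have h := Nat.lt_mul_div_succ N htpos
    rw [← hr] at h
    nlinarith
  refine ⟨r, hr1, hr2, hr3, fun S hS => ?_⟩
  have hNpos : 0 < N := by omega
  have hN0 : (0 : ℝ) < N := by exact_mod_cast hNpos
  have hN1' : (1 : ℝ) ≤ N := by exact_mod_cast hNpos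
  -- The exponent uses `m + 1` instead of `m`. Together with `t = m + 2` this makes `N * (s / N) ^
  -- t` equal to `N ^ (-1 / (m + 1))`, so the advantage falls below any `η`.
  set s : ℝ := (N : ℝ) ^ (1 - 1 / ((m : ℝ) + 1)) with hs
  have hs0 : 0 < s := Real.rpow_pos_of_pos hN0 _
  have hSs : (S : ℝ) ≤ s := by
    refine hS.le.trans (Real.rpow_le_rpow_of_exponent_le hN1' ?_)
    have : 1 / ((m : ℝ) + 1) ≤ 1 / m := by gcongr; linarith
    linarith
  have hr3' : (N : ℝ) ≤ 4 * (768 * (r * t) : ℕ) := by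
    have : N ≤ 4 * (768 * (r * t)) := by omega
    exact_mod_cast this
  have hrN : (r : ℝ) ≤ N := by
    have : r ≤ N := Nat.div_le_self _ _
    exact_mod_cast this
  have hn0 : (0 : ℝ) < (768 * (r * t) : ℕ) := by linarith
  have hA : 4 * (r * (16 * s / (768 * (r * t) : ℕ)) ^ t) ≤ θ ^ 2 := by
    have h1 : 16 * s / (768 * (r * t) : ℕ) ≤ 64 * (N : ℝ) ^ (-(1 / ((m : ℝ) + 1))) := by
      rw [div_le_iff₀ hn0]
      have : s = N * (N : ℝ) ^ (-(1 / ((m : ℝ) + 1))) := by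
        rw [hs, sub_eq_add_neg, Real.rpow_add hN0, Real.rpow_one]
      rw [this]
      have hp : 0 < (N : ℝ) ^ (-(1 / ((m : ℝ) + 1))) := Real.rpow_pos_of_pos hN0 _
      nlinarith
    have h2 : (N : ℝ) * ((N : ℝ) ^ (-(1 / ((m : ℝ) + 1)))) ^ t =
        (N : ℝ) ^ (-(1 / ((m : ℝ) + 1))) := by
      rw [← Real.rpow_natCast, ← Real.rpow_mul hN0.le]
      nth_rewrite 1 [← Real.rpow_one (N : ℝ)]
      rw [← Real.rpow_add hN0]
      congr 1
      rw [ht]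
      push_cast
      field_simp
      ring
    calc 4 * (r * (16 * s / (768 * (r * t) : ℕ)) ^ t)
        ≤ 4 * (N * (64 * (N : ℝ) ^ (-(1 / ((m : ℝ) + 1)))) ^ t) := by gcongr
      _ = 4 * 64 ^ t * (N * ((N : ℝ) ^ (-(1 / ((m : ℝ) + 1)))) ^ t) := by
          rw [mul_pow]
          ring
      _ ≤ θ ^ 2 := by
          rw [h2]
          exact hN1.le
  calc ∑ k ∈ Finset.Icc 1 r, levelBound (768 * (r * t)) S t r k
      ≤ ∑ k ∈ Finset.Icc 1 r, (1 / 2 : ℝ) ^ k * θ := by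
        refine Finset.sum_le_sum fun k hk => ?_
        obtain ⟨hk1, hkr⟩ := Finset.mem_Icc.1 hk
        refine levelBound_le rfl (by omega) hk1 hkr hSs hθ0.le (min_le_right _ _) hA fun hsk => ?_
        have h3 : (t * k₀ : ℝ) < t * k := by
          rw [mul_comm (t : ℝ) k]
          exact hN2.trans_lt hsk
        have h4 : k₀ < k := by
          have : (0 : ℝ) < t := by
            rw [ht]
            positivity
          exact_mod_cast lt_of_mul_lt_mul_left h3 this.le
        exact (pow_le_pow_of_le_one (by norm_num) (by norm_num) h4.le).trans hk₀.le
    _ ≤ θ := by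
        rw [← Finset.sum_mul]
        exact mul_le_of_le_one_left hθ0.le (sum_Icc_half_pow_le r)
    _ ≤ η := min_le_left _ _

/-! ### Sums over singular values of structured matrices -/

/-- The sum of `f` over the singular values of a square matrix with any index type. -/
noncomputable def singularSum (f : ℝ → ℝ) {I : Type*} [Fintype I] [DecidableEq I]
    (B : Matrix I I ℝ) : ℝ :=
  ((B.transpose * B).charpoly.roots.map fun y => f √y).sum

theorem spectralSum_eq_singularSum (f : ℝ → ℝ) {N : ℕ} (X : Matrix (Fin N) (Fin N) ℝ) :
    spectralSum f X = singularSum f X := by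
  have hn : Module.finrank ℝ (EuclideanSpace ℝ (Fin N)) = N := by simp
  set T := Matrix.toEuclideanLin X with hT
  have hc : (T.adjoint ∘ₗ T).charpoly = (X.transpose * X).charpoly := by
    rw [hT, ← Matrix.toEuclideanLin_conjTranspose_eq_adjoint, Matrix.toEuclideanLin_eq_toLin_orthonormal,
      ← Matrix.toLin_mul, Matrix.charpoly_toLin,
      Matrix.conjTranspose_eq_transpose_of_trivial]
  have hr := T.isSymmetric_adjoint_comp_self.roots_charpoly_eq_eigenvalues hn
  rw [singularSum, ← hc, hr, Multiset.map_map, spectralSum]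
  simp only [← hT, T.singularValues_fin hn]
  rfl

section SingularSum

set_option linter.unusedSectionVars false

variable (f : ℝ → ℝ) {I J : Type*} [Fintype I] [DecidableEq I] [Fintype J] [DecidableEq J]

/-- Rows and columns may be permuted independently: the row permutation cancels in the Gram matrix
and the column permutation conjugates it. -/
theorem singularSum_submatrix (e₁ e₂ : J ≃ I) (B : Matrix I I ℝ) :
    singularSum f (B.submatrix e₁ e₂) = singularSum f B := by
  have h : (B.submatrix e₁ e₂).transpose * B.submatrix e₁ e₂ =
      Matrix.reindex e₂.symm e₂.symm (B.transpose * B) := by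
    rw [Matrix.transpose_submatrix, Matrix.submatrix_mul_equiv]
    rfl
  rw [singularSum, h, Matrix.charpoly_reindex, singularSum]

theorem singularSum_fromBlocks (A : Matrix I I ℝ) (D : Matrix J J ℝ) :
    singularSum f (Matrix.fromBlocks A 0 0 D) = singularSum f A + singularSum f D := by
  rw [singularSum, Matrix.fromBlocks_transpose, Matrix.fromBlocks_multiply]
  simp only [Matrix.transpose_zero, Matrix.mul_zero, Matrix.zero_mul, add_zero, zero_add]
  rw [Matrix.charpoly_fromBlocks_zero₁₂, Polynomial.roots_mul
    (mul_ne_zero (Matrix.charpoly_monic _).ne_zero (Matrix.charpoly_monic _).ne_zero),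
    Multiset.map_add, Multiset.sum_add, singularSum, singularSum]

theorem charpoly_blockDiagonal (M : J → Matrix I I ℝ) :
    (Matrix.blockDiagonal M).charpoly = ∏ j, (M j).charpoly := by
  have h : (Matrix.blockDiagonal M).charmatrix = Matrix.blockDiagonal fun j => (M j).charmatrix := by
    ext ⟨i, j⟩ ⟨i', j'⟩
    by_cases hj : j = j'
    · subst hj
      simp [Matrix.charmatrix_apply, Matrix.blockDiagonal_apply, Matrix.diagonal_apply]
    · simp [Matrix.blockDiagonal_apply, hj]
  rw [Matrix.charpoly, h, Matrix.det_blockDiagonal]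
  rfl

theorem singularSum_blockDiagonal_const (B : Matrix I I ℝ) :
    singularSum f (Matrix.blockDiagonal fun _ : J => B) = Fintype.card J * singularSum f B := by
  rw [singularSum, Matrix.blockDiagonal_transpose, ← Matrix.blockDiagonal_mul,
    charpoly_blockDiagonal, Finset.prod_const, Polynomial.roots_pow, Multiset.map_nsmul,
    Multiset.sum_nsmul, nsmul_eq_mul, singularSum, Finset.card_univ]

theorem roots_prod_X_sub_C (g : I → ℝ) :
    (∏ i, (Polynomial.X - Polynomial.C (g i))).roots = Finset.univ.val.map g := by
  rw [← Polynomial.roots_multiset_prod_X_sub_C (Finset.univ.val.map g), Multiset.map_map]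
  rfl

/-- One family `σ`, the roots of the Gram eigenvalues, serves every function, scale and power;
functional calculus supplies the characteristic polynomials of the scaled and powered Gram matrices.
-/
theorem exists_singularValues (B : Matrix I I ℝ) :
    ∃ σ : I → ℝ, (∀ i, 0 ≤ σ i) ∧
      (∀ (f : ℝ → ℝ) (ε : ℝ), 0 ≤ ε → singularSum f (ε • B) = ∑ i, f (ε * σ i)) ∧
      ∀ p : ℕ, ∑ i, σ i ^ (2 * p) = ((B.transpose * B) ^ p).trace := by
  have hB : (B.transpose * B).PosSemidef := by
    simpa using Matrix.posSemidef_conjTranspose_mul_self B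
  have hG := hB.isHermitian
  refine ⟨fun i => √(hG.eigenvalues i), fun i => Real.sqrt_nonneg _, fun f ε hε => ?_, fun p => ?_⟩
  · have hp := hG.charpoly_cfc_eq fun y => ε * ε * y
    rw [cfc_const_mul_id (ε * ε) (B.transpose * B) hG.isSelfAdjoint] at hp
    rw [singularSum, Matrix.transpose_smul, Matrix.smul_mul, Matrix.mul_smul, smul_smul, hp]
    simp only [RCLike.ofReal_real_eq_id, id]
    rw [roots_prod_X_sub_C, Multiset.map_map]
    refine Finset.sum_congr rfl fun i _ => ?_
    simp [Real.sqrt_mul (mul_nonneg hε hε), Real.sqrt_mul_self hε]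
  · have hp := hG.charpoly_cfc_eq fun y => y ^ p
    rw [cfc_pow_id (B.transpose * B) p hG.isSelfAdjoint] at hp
    simp only [RCLike.ofReal_real_eq_id, id] at hp
    have hs : ((B.transpose * B) ^ p).charpoly.Splits := by
      rw [hp]
      exact Polynomial.Splits.prod fun i _ => Polynomial.Splits.X_sub_C _
    rw [Matrix.trace_eq_sum_roots_charpoly_of_splits hs, hp, roots_prod_X_sub_C]
    refine Finset.sum_congr rfl fun i _ => ?_
    rw [pow_mul, Real.sq_sqrt (hB.eigenvalues_nonneg i)]

theorem singularSum_smul_one {ε : ℝ} (hε : 0 ≤ ε) :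
    singularSum f (ε • (1 : Matrix I I ℝ)) = Fintype.card I * f ε := by
  rw [singularSum, Matrix.transpose_smul, Matrix.transpose_one, Matrix.smul_mul, Matrix.one_mul,
    smul_smul, Matrix.smul_one_eq_diagonal, Matrix.charpoly_diagonal, roots_prod_X_sub_C]
  simp [Real.sqrt_mul_self hε]

end SingularSum

/-! ### The double cover of a cycle -/

section Cycle

open scoped Fin.CommRing

variable {t : ℕ} [NeZero t]

/-- The permutation of `Fin t × ZMod 2` which consists of two `t`-cycles for `p = 0` and is one
`2 t`-cycle for `p = 1`. -/
def coverShift (p : ZMod 2) : Equiv.Perm (Fin t × ZMod 2) where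
  toFun y := (y.1 + 1, y.2 + if y.1 + 1 = 0 then p else 0)
  invFun y := (y.1 - 1, y.2 - if y.1 = 0 then p else 0)
  left_inv y := by simp
  right_inv y := by simp

theorem coverShift_apply (p : ZMod 2) (y : Fin t × ZMod 2) :
    coverShift p y = (y.1 + 1, y.2 + if y.1 + 1 = 0 then p else 0) := rfl

theorem fst_coverShift_pow (p : ZMod 2) (j : ℕ) (y : Fin t × ZMod 2) :
    ((coverShift p ^ j) y).1 = y.1 + (j : Fin t) := by
  induction j with
  | zero => simp
  | succ j ih => rw [pow_succ', Equiv.Perm.mul_apply, coverShift_apply, ih]; simp [add_assoc]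

theorem coverShift_zero_pow (j : ℕ) (y : Fin t × ZMod 2) :
    (coverShift 0 ^ j) y = (y.1 + (j : Fin t), y.2) := by
  induction j with
  | zero => simp
  | succ j ih => rw [pow_succ', Equiv.Perm.mul_apply, coverShift_apply, ih]; simp [add_assoc]

theorem coverShift_one_pow (j : ℕ) (hj : j < t) :
    (coverShift 1 ^ j) ((0, 0) : Fin t × ZMod 2) = ((j : Fin t), 0) := by
  induction j with
  | zero => simp
  | succ j ih =>
    rw [pow_succ', Equiv.Perm.mul_apply, coverShift_apply, ih (by omega)]
    have : ¬ (((j + 1 : ℕ) : Fin t) = 0) := by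
      rw [Fin.natCast_eq_zero]
      exact Nat.not_dvd_of_pos_of_lt (Nat.succ_pos j) hj
    rw [Nat.cast_succ] at this
    simp [this]

theorem coverShift_one_pow_self :
    (coverShift 1 ^ t) ((0, 0) : Fin t × ZMod 2) = (0, 1) := by
  obtain ⟨d, hd⟩ : ∃ d, t = d + 1 := ⟨t - 1, (Nat.succ_pred_eq_of_pos (NeZero.pos t)).symm⟩
  have h0 : ((d : Fin t) + 1) = 0 := by
    rw [← Nat.cast_succ, Fin.natCast_eq_zero]
    exact dvd_of_eq hd
  rw [show (coverShift 1 ^ t : Equiv.Perm (Fin t × ZMod 2)) = coverShift 1 ^ (d + 1) by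
    congr 1, pow_succ', Equiv.Perm.mul_apply, coverShift_one_pow d (by omega), coverShift_apply]
  simp [h0]

/-- The biadjacency matrix of the cycles of `coverShift`. -/
def coverMatrix (p : ZMod 2) : Matrix (Fin t × ZMod 2) (Fin t × ZMod 2) ℝ :=
  1 + (coverShift p).permMatrix ℝ

theorem permMatrix_pow {I : Type*} [Fintype I] [DecidableEq I] (σ : Equiv.Perm I) (j : ℕ) :
    (σ.permMatrix ℝ) ^ j = (σ ^ j).permMatrix ℝ := by
  induction j with
  | zero => simp
  | succ j ih => rw [pow_succ', pow_succ, ih, Matrix.permMatrix_mul]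

/-- The transpose is `1` plus the inverse permutation matrix and commutes with the matrix itself.
Expand both powers binomially; the trace of a permutation matrix counts fixed points. -/
theorem trace_one_add_permMatrix {I : Type*} [Fintype I] [DecidableEq I] (σ : Equiv.Perm I)
    (p : ℕ) :
    (((1 + σ.permMatrix ℝ).transpose * (1 + σ.permMatrix ℝ)) ^ p).trace =
      ∑ i ∈ Finset.range (p + 1), ∑ j ∈ Finset.range (p + 1),
        (p.choose i * p.choose j : ℝ) * {y | (σ ^ j) y = (σ ^ i) y}.ncard := by
  have h1 : (σ⁻¹).permMatrix ℝ * σ.permMatrix ℝ = 1 := by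
    rw [← Matrix.permMatrix_mul, mul_inv_cancel, Matrix.permMatrix_one]
  have h2 : σ.permMatrix ℝ * (σ⁻¹).permMatrix ℝ = 1 := by
    rw [← Matrix.permMatrix_mul, inv_mul_cancel, Matrix.permMatrix_one]
  have hcomm : Commute (1 + (σ⁻¹).permMatrix ℝ) (1 + σ.permMatrix ℝ) := by
    have : Commute ((σ⁻¹).permMatrix ℝ) (σ.permMatrix ℝ) := h1.trans h2.symm
    exact (Commute.one_left _).add_left ((Commute.one_right _).add_right this)
  rw [Matrix.transpose_add, Matrix.transpose_one, Matrix.transpose_permMatrix, hcomm.mul_pow,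
    add_comm 1, add_comm 1, (Commute.one_right _).add_pow, (Commute.one_right _).add_pow,
    Finset.sum_mul_sum, Matrix.trace_sum]
  refine Finset.sum_congr rfl fun i _ => ?_
  rw [Matrix.trace_sum]
  refine Finset.sum_congr rfl fun j _ => ?_
  have e : ((σ⁻¹).permMatrix ℝ ^ i * 1 ^ (p - i) * (p.choose i : Matrix I I ℝ)) *
      (σ.permMatrix ℝ ^ j * 1 ^ (p - j) * (p.choose j : Matrix I I ℝ)) =
      (p.choose i * p.choose j : ℝ) • ((σ⁻¹).permMatrix ℝ ^ i * σ.permMatrix ℝ ^ j) := by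
    rw [one_pow, one_pow, mul_one, mul_one, ← Nat.cast_comm, ← Nat.cast_comm, mul_smul,
      Nat.cast_smul_eq_nsmul, Nat.cast_smul_eq_nsmul, nsmul_eq_mul, nsmul_eq_mul]
    simp only [mul_assoc]
    rw [← mul_assoc _ (p.choose j : Matrix I I ℝ), ← Nat.cast_comm (p.choose j), mul_assoc]
  rw [e, Matrix.trace_smul, Matrix.trace_mul_comm, permMatrix_pow, permMatrix_pow,
    ← Matrix.permMatrix_mul, Matrix.trace_permutation, smul_eq_mul]
  congr 3
  ext y
  rw [Function.mem_fixedPoints, Function.IsFixedPt, Equiv.Perm.mul_apply, inv_pow,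
    Equiv.Perm.inv_eq_iff_eq]
  rfl

/-- Both shifts move the base point alike, and for parity `0` the fibre coordinate never changes, so
every coincidence for parity `1` is also one for parity `0`. The pair of exponents `(0, t)` is
strict: going once around swaps the sheets only for parity `1`. -/
theorem trace_coverMatrix_lt {p : ℕ} (hp : t ≤ p) :
    ((((coverMatrix 1 : Matrix (Fin t × ZMod 2) _ ℝ)).transpose * coverMatrix 1) ^ p).trace <
      ((((coverMatrix 0 : Matrix (Fin t × ZMod 2) _ ℝ)).transpose * coverMatrix 0) ^ p).trace := by
  have hsub : ∀ i j : ℕ, {y : Fin t × ZMod 2 | (coverShift 1 ^ j) y = (coverShift 1 ^ i) y} ⊆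
      {y | (coverShift 0 ^ j) y = (coverShift 0 ^ i) y} := by
    intro i j y hy
    have := congrArg Prod.fst hy
    rw [fst_coverShift_pow, fst_coverShift_pow] at this
    simp only [Set.mem_ofPred_eq, coverShift_zero_pow, this]
  have hle : ∀ i j : ℕ,
      ({y : Fin t × ZMod 2 | (coverShift 1 ^ j) y = (coverShift 1 ^ i) y}.ncard : ℝ) ≤
        {y : Fin t × ZMod 2 | (coverShift 0 ^ j) y = (coverShift 0 ^ i) y}.ncard := fun i j => by
    exact_mod_cast Set.ncard_le_ncard (hsub i j) (Set.toFinite _)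
  have hlt : ({y : Fin t × ZMod 2 | (coverShift 1 ^ t) y = (coverShift 1 ^ 0) y}.ncard : ℝ) <
      {y : Fin t × ZMod 2 | (coverShift 0 ^ t) y = (coverShift 0 ^ 0) y}.ncard := by
    have : {y : Fin t × ZMod 2 | (coverShift 1 ^ t) y = (coverShift 1 ^ 0) y} ⊂
        {y : Fin t × ZMod 2 | (coverShift 0 ^ t) y = (coverShift 0 ^ 0) y} := by
      refine ⟨hsub 0 t, fun h => ?_⟩
      have h0 : ((0, 0) : Fin t × ZMod 2) ∈
          {y : Fin t × ZMod 2 | (coverShift 0 ^ t) y = (coverShift 0 ^ 0) y} := by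
        simp [coverShift_zero_pow]
      have := h h0
      rw [Set.mem_ofPred_eq, coverShift_one_pow_self] at this
      simp at this
    exact_mod_cast Set.ncard_lt_ncard this (Set.toFinite _)
  rw [coverMatrix, coverMatrix, trace_one_add_permMatrix, trace_one_add_permMatrix]
  refine Finset.sum_lt_sum (fun i _ => Finset.sum_le_sum fun j _ => ?_) ⟨0, by simp, ?_⟩
  · exact mul_le_mul_of_nonneg_left (hle i j) (by positivity)
  · refine Finset.sum_lt_sum (fun j _ => ?_) ⟨t, by simp; omega, ?_⟩
    · exact mul_le_mul_of_nonneg_left (hle 0 j) (by positivity)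
    · have : 0 < p.choose t := Nat.choose_pos hp
      exact mul_lt_mul_of_pos_left hlt (by simp; positivity)

end Cycle

/-! ### Separation of the two covers by a function with a Taylor expansion -/

theorem HasTaylorExpansion.sum_comp_mul {f : ℝ → ℝ} {a : ℕ → ℝ} (hf : HasTaylorExpansion f a)
    {I : Type*} [Fintype I] (σ : I → ℝ) (hσ : ∀ i, 0 ≤ σ i) :
    HasTaylorExpansion (fun x => ∑ i, f (x * σ i)) fun k => a k * ∑ i, σ i ^ k := by
  intro n
  have h1 : ∀ i, (fun x => f (x * σ i) - ∑ k ∈ Finset.range n, a k * (x * σ i) ^ k)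
      =O[𝓝[≥] 0] fun x => x ^ n := by
    intro i
    have ht : Tendsto (fun x : ℝ => x * σ i) (𝓝[≥] 0) (𝓝[≥] 0) := by
      refine tendsto_nhdsWithin_iff.2 ⟨?_, ?_⟩
      · have : Tendsto (fun x : ℝ => x * σ i) (𝓝 0) (𝓝 (0 * σ i)) :=
          (continuous_mul_const (σ i)).tendsto 0
        rw [zero_mul] at this
        exact this.mono_left nhdsWithin_le_nhds
      · filter_upwards [self_mem_nhdsWithin] with x hx using mul_nonneg hx (hσ i)
    refine ((hf n).comp_tendsto ht).trans ?_
    have : (fun x : ℝ => (x * σ i) ^ n) = fun x => σ i ^ n * x ^ n := by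
      ext x
      rw [mul_pow, mul_comm]
    change (fun x : ℝ => (x * σ i) ^ n) =O[_] _
    rw [this]
    exact isBigO_const_mul_self _ _ _
  refine (IsBigO.sum fun i (_ : i ∈ Finset.univ) => h1 i).congr_left fun x => ?_
  rw [Finset.sum_apply, Finset.sum_sub_distrib, Finset.sum_comm]
  congr 1
  refine Finset.sum_congr rfl fun k _ => ?_
  rw [mul_assoc, Finset.sum_mul, Finset.mul_sum]
  exact Finset.sum_congr rfl fun i _ => by rw [mul_pow]; ring

theorem HasTaylorExpansion.sub {f g : ℝ → ℝ} {a b : ℕ → ℝ} (hf : HasTaylorExpansion f a)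
    (hg : HasTaylorExpansion g b) :
    HasTaylorExpansion (fun x => f x - g x) fun k => a k - b k := by
  intro n
  refine ((hf n).sub (hg n)).congr_left fun x => ?_
  simp only [sub_mul, Finset.sum_sub_distrib]
  ring

/-- At a first nonzero coefficient, `d n * x ^ n` would be `O(x ^ (n + 1))` along `x = 1 / q`.
Testing these points alone yields a scale that is the reciprocal of an integer. -/
theorem HasTaylorExpansion.coeff_eq_zero {g : ℝ → ℝ} {d : ℕ → ℝ} (hg : HasTaylorExpansion g d)
    (h0 : ∀ q : ℕ, 1 ≤ q → g (1 / q) = 0) (n : ℕ) : d n = 0 := by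
  induction n using Nat.strong_induction_on with
  | _ n ih =>
  by_contra hd
  have ht : Tendsto (fun q : ℕ => 1 / ((q : ℝ) + 1)) atTop (𝓝[≥] 0) :=
    tendsto_nhdsWithin_iff.2 ⟨tendsto_one_div_add_atTop_nhds_zero_nat,
      Eventually.of_forall fun q => by simp only [Set.mem_Ici]; positivity⟩
  have h1 := (hg (n + 1)).comp_tendsto ht
  have h2 : (fun q : ℕ => d n * (1 / ((q : ℝ) + 1)) ^ n) =O[atTop]
      fun q : ℕ => (1 / ((q : ℝ) + 1)) ^ (n + 1) := by
    refine h1.neg_left.congr_left fun q => ?_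
    have hq := h0 (q + 1) (by omega)
    push_cast at hq
    simp only [Function.comp_apply, hq]
    rw [Finset.sum_range_succ, Finset.sum_eq_zero fun k hk => by
      rw [ih k (Finset.mem_range.1 hk), zero_mul]]
    ring
  have h3 : (fun q : ℕ => (1 / ((q : ℝ) + 1)) ^ (n + 1)) =o[atTop]
      fun q : ℕ => (1 / ((q : ℝ) + 1)) ^ n := by
    have := (isLittleO_pow_pow (𝕜 := ℝ) (Nat.lt_succ_self n)).comp_tendsto
      (ht.mono_right nhdsWithin_le_nhds)
    exact this
  have h4 := (isLittleO_const_mul_left_iff hd).1 (h2.trans_isLittleO h3)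
  refine isLittleO_irrefl (Eventually.frequently (Eventually.of_forall fun q => ?_)) h4
  positivity

theorem exists_singularSum_coverMatrix_ne {f : ℝ → ℝ} {a : ℕ → ℝ} (hf : HasTaylorExpansion f a)
    (ha : {k : ℕ | Even k ∧ a k ≠ 0}.Infinite) (t : ℕ) [NeZero t] :
    ∃ q : ℕ, 1 ≤ q ∧
      singularSum f ((1 / q : ℝ) • (coverMatrix 0 : Matrix (Fin t × ZMod 2) _ ℝ)) ≠
        singularSum f ((1 / q : ℝ) • (coverMatrix 1 : Matrix (Fin t × ZMod 2) _ ℝ)) := by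
  by_contra! hcon
  obtain ⟨σ, hσ0, hσ, hσt⟩ := exists_singularValues (coverMatrix 0 : Matrix (Fin t × ZMod 2) _ ℝ)
  obtain ⟨τ, hτ0, hτ, hτt⟩ := exists_singularValues (coverMatrix 1 : Matrix (Fin t × ZMod 2) _ ℝ)
  have hz := ((hf.sum_comp_mul σ hσ0).sub (hf.sum_comp_mul τ hτ0)).coeff_eq_zero fun q hq => by
    have := hcon q hq
    rw [hσ f _ (by positivity), hτ f _ (by positivity)] at this
    exact sub_eq_zero.2 this
  obtain ⟨k, ⟨⟨p, rfl⟩, hk⟩, hkt⟩ := ha.exists_gt (2 * t)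
  have h := hz (p + p)
  rw [← mul_sub, ← two_mul, hσt, hτt] at h
  rcases mul_eq_zero.1 h with h | h
  · exact hk (two_mul p ▸ h)
  · exact (sub_pos.2 (trace_coverMatrix_lt (t := t) (p := p) (by omega))).ne' h

/-! ### The streams of the reduction -/

theorem streamMatrix_append {N : ℕ} (s₁ s₂ : List (Update N)) :
    streamMatrix (s₁ ++ s₂) = streamMatrix s₁ + streamMatrix s₂ := by
  simp [streamMatrix]

theorem streamMatrix_map_toList {N : ℕ} {K : Type*} [Fintype K] (α β : K → Fin N) (ε : ℝ) :
    streamMatrix ((Finset.univ : Finset K).toList.map fun k => (α k, β k, ε)) =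
      ∑ k, Matrix.single (α k) (β k) ε := by
  rw [streamMatrix, List.map_map, ← Finset.sum_map_toList]
  rfl

/-- The map `(i, b) ↦ (π i, b + g i)`. -/
def shear {I : Type*} (π : Equiv.Perm I) (g : I → ZMod 2) : Equiv.Perm (I × ZMod 2) where
  toFun k := (π k.1, k.2 + g k.1)
  invFun k := (π.symm k.1, k.2 - g (π.symm k.1))
  left_inv k := by simp
  right_inv k := by simp

section Reduction

variable {r t u v N : ℕ}

/-- The updates which encode the bits of `x`. -/
noncomputable def itemStream (e : (((Fin r × Fin t) ⊕ Fin u) × ZMod 2) ⊕ Fin v ≃ Fin N) (ε : ℝ)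
    (x : (Fin r × Fin t) ⊕ Fin u → ZMod 2) : List (Update N) :=
  (Finset.univ : Finset (((Fin r × Fin t) ⊕ Fin u) × ZMod 2)).toList.map fun k =>
    (e (Sum.inl k), e (Sum.inl (k.1, k.2 + x k.1)), ε)

theorem length_itemStream (e : (((Fin r × Fin t) ⊕ Fin u) × ZMod 2) ⊕ Fin v ≃ Fin N) (ε : ℝ)
    (x : (Fin r × Fin t) ⊕ Fin u → ZMod 2) :
    (itemStream e ε x).length = (r * t + u) * 2 := by
  simp [itemStream]

variable [NeZero t]

/-- The updates which encode the hyperedges `π ({j} × Fin t)` with the bits `w j`. -/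
noncomputable def edgeStream (e : (((Fin r × Fin t) ⊕ Fin u) × ZMod 2) ⊕ Fin v ≃ Fin N) (ε : ℝ)
    (π : Equiv.Perm ((Fin r × Fin t) ⊕ Fin u)) (w : Fin r → ZMod 2) : List (Update N) :=
  (Finset.univ : Finset ((Fin r × Fin t) × ZMod 2)).toList.map fun k =>
    (e (Sum.inl (π (Sum.inl k.1), k.2)),
      e (Sum.inl (π (Sum.inl (k.1.1, k.1.2 + 1)), k.2 + if k.1.2 + 1 = 0 then w k.1.1 else 0)), ε)

variable (e : (((Fin r × Fin t) ⊕ Fin u) × ZMod 2) ⊕ Fin v ≃ Fin N) (ε : ℝ)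

theorem length_edgeStream (π : Equiv.Perm ((Fin r × Fin t) ⊕ Fin u)) (w : Fin r → ZMod 2) :
    (edgeStream e ε π w).length = r * t * 2 := by
  simp [edgeStream]

theorem isInsertionStream_append (ht : 2 ≤ t) (x : (Fin r × Fin t) ⊕ Fin u → ZMod 2)
    (π : Equiv.Perm ((Fin r × Fin t) ⊕ Fin u)) (w : Fin r → ZMod 2) :
    IsInsertionStream ε (itemStream e ε x ++ edgeStream e ε π w) := by
  refine ⟨?_, ?_⟩
  · rw [List.map_append, List.nodup_append']
    refine ⟨?_, ?_, ?_⟩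
    · rw [itemStream, List.map_map]
      refine (List.nodup_map_iff fun k l h => ?_).2 (Finset.nodup_toList _)
      simpa using congrArg Prod.fst h
    · rw [edgeStream, List.map_map]
      refine (List.nodup_map_iff fun k l h => ?_).2 (Finset.nodup_toList _)
      have := congrArg Prod.fst h
      simp only [Function.comp_apply, e.injective.eq_iff, Sum.inl.injEq, Prod.mk.injEq,
        π.injective.eq_iff] at this
      exact Prod.ext this.1 this.2
    · rw [itemStream, edgeStream, List.map_map, List.map_map]
      intro y hy hy'
      obtain ⟨k, -, rfl⟩ := List.mem_map.1 hy
      obtain ⟨l, -, hl⟩ := List.mem_map.1 hy'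
      -- Alice's entries join an item to itself, Bob's join cyclically consecutive items; these
      -- differ because `t ≥ 2`.
      simp only [Function.comp_apply, e.injective.eq_iff, Sum.inl.injEq, Prod.mk.injEq] at hl
      have h := (congrArg Prod.fst hl.1).trans hl.2.1.symm
      rw [π.injective.eq_iff, Sum.inl.injEq] at h
      have h2 : l.1.2 = l.1.2 + 1 := congrArg Prod.snd h
      rw [left_eq_add, Fin.one_eq_zero_iff] at h2
      omega
  · intro y hy
    rcases List.mem_append.1 hy with h | h
    · obtain ⟨k, -, rfl⟩ := List.mem_map.1 h
      rfl
    · obtain ⟨k, -, rfl⟩ := List.mem_map.1 h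
      rfl

/-- The cocycle identity for tail sums around a cycle: away from the wrap a tail loses one term, and
at the wrap the full sum cancels in characteristic two. -/
theorem sum_Ioi_add_one (g : Fin t → ZMod 2) (s : Fin t) :
    ∑ i ∈ Finset.Ioi (s + 1), g i + g (s + 1) +
      (if s + 1 = 0 then ∑ i, g i else 0) = ∑ i ∈ Finset.Ioi s, g i := by
  obtain ⟨d, rfl⟩ : ∃ d, t = d + 1 :=
    ⟨t - 1, (Nat.succ_pred_eq_of_pos (NeZero.pos t)).symm⟩
  have hnot : s + 1 ∉ Finset.Ioi (s + 1) := by simp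
  rw [add_comm (∑ i ∈ Finset.Ioi (s + 1), g i), ← Finset.sum_insert hnot]
  by_cases hs : s = Fin.last d
  · subst hs
    have h1 : insert (Fin.last d + 1) (Finset.Ioi (Fin.last d + 1)) = Finset.univ := by
      ext i
      simp [Fin.last_add_one, eq_or_ne i 0]
    have h2 : Finset.Ioi (Fin.last d) = ∅ := by
      ext i
      simp [Fin.le_last]
    rw [h1, h2, if_pos (Fin.last_add_one d), CharTwo.add_self_eq_zero, Finset.sum_empty]
  · have hv : (s + 1).val = s.val + 1 := by
      rw [Fin.val_add_one, if_neg hs]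
    rw [if_neg fun h0 => by simp [h0] at hv, add_zero]
    congr 1
    ext i
    rw [Finset.mem_insert, Finset.mem_Ioi, Finset.mem_Ioi, Fin.ext_iff, Fin.lt_def, Fin.lt_def, hv]
    omega

/-- A gauge transformation: relabelling the two sheets over each item by tail sums of `x` along its
hyperedge makes Alice's part diagonal and pushes all twisting to the wrap edge, where it adds up to
parity plus `w j`. -/
theorem streamMatrix_reduction (x : (Fin r × Fin t) ⊕ Fin u → ZMod 2)
    (π : Equiv.Perm ((Fin r × Fin t) ⊕ Fin u)) (w : Fin r → ZMod 2) (p : ZMod 2)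
    (hw : ∀ j, edgeParity π x j + w j = p) :
    ∃ α β : Equiv.Perm (((Fin r × Fin t) ⊕ Fin u) × ZMod 2),
      streamMatrix (itemStream e ε x ++ edgeStream e ε π w) =
        ∑ k, Matrix.single (e (Sum.inl (α k))) (e (Sum.inl (β k))) ε +
        ∑ k : (Fin r × Fin t) × ZMod 2, Matrix.single (e (Sum.inl (α (Sum.inl k.1, k.2))))
          (e (Sum.inl (β (Sum.inl (k.1.1, k.1.2 + 1),
            k.2 + if k.1.2 + 1 = 0 then p else 0)))) ε := by
  set h : (Fin r × Fin t) ⊕ Fin u → ZMod 2 :=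
    Sum.elim (fun k => ∑ s ∈ Finset.Ioi k.2, x (π (Sum.inl (k.1, s)))) fun _ => 0 with hh
  refine ⟨shear π h, shear π fun i => h i + x (π i), ?_⟩
  rw [streamMatrix_append, itemStream, edgeStream, streamMatrix_map_toList, streamMatrix_map_toList]
  congr 1
  · rw [← Equiv.sum_comp (shear π h)]
    simp [shear, add_assoc]
  · rw [← Equiv.sum_comp (shear (Equiv.refl _) fun k => h (Sum.inl k))]
    refine Finset.sum_congr rfl fun k _ => ?_
    have h1 := sum_Ioi_add_one (fun s => x (π (Sum.inl (k.1.1, s)))) k.1.2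
    have h2 := hw k.1.1
    simp only [edgeParity] at h2
    congr 3
    refine Prod.ext rfl ?_
    simp only [shear, Equiv.coe_fn_mk, Equiv.refl_apply, hh, Sum.elim_inl]
    split_ifs with hs
    · rw [if_pos hs] at h1
      rw [← h1, ← h2]
      ring
    · rw [if_neg hs] at h1
      rw [← h1]
      ring

/-- The layout of rows and columns which shows the cycles as diagonal blocks. -/
def cycleLayout : (((Fin t × ZMod 2) × Fin r) ⊕ (Fin u × ZMod 2)) ⊕ Fin v ≃
    (((Fin r × Fin t) ⊕ Fin u) × ZMod 2) ⊕ Fin v :=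
  Equiv.sumCongr
    { toFun := Sum.elim (fun k => (Sum.inl (k.2, k.1.1), k.1.2)) fun k => (Sum.inr k.1, k.2)
      invFun := fun k => match k with
        | (Sum.inl i, b) => Sum.inl ((i.2, b), i.1)
        | (Sum.inr i, b) => Sum.inr (i, b)
      left_inv := by rintro (k | k) <;> rfl
      right_inv := by rintro ⟨k | k, b⟩ <;> rfl } (Equiv.refl _)

theorem spectralSum_reduction (f : ℝ → ℝ) (hε : 0 ≤ ε) (x : (Fin r × Fin t) ⊕ Fin u → ZMod 2)
    (π : Equiv.Perm ((Fin r × Fin t) ⊕ Fin u)) (w : Fin r → ZMod 2) (p : ZMod 2)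
    (hw : ∀ j, edgeParity π x j + w j = p) :
    spectralSum f (streamMatrix (itemStream e ε x ++ edgeStream e ε π w)) =
      r * singularSum f (ε • (coverMatrix p : Matrix (Fin t × ZMod 2) _ ℝ)) +
        u * 2 * f ε + v * f 0 := by
  obtain ⟨α, β, hX⟩ := streamMatrix_reduction e ε x π w p hw
  set X := streamMatrix (itemStream e ε x ++ edgeStream e ε π w) with hXdef
  have key : X.submatrix ((cycleLayout.trans (Equiv.sumCongr α (Equiv.refl _))).trans e)
      ((cycleLayout.trans (Equiv.sumCongr β (Equiv.refl _))).trans e) =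
      Matrix.fromBlocks (Matrix.fromBlocks
        (Matrix.blockDiagonal fun _ : Fin r => ε • (coverMatrix p : Matrix (Fin t × ZMod 2) _ ℝ))
        0 0 (ε • 1)) 0 0 ((0 : ℝ) • 1) := by
    rw [hX]
    ext (((⟨⟨s, b⟩, j⟩) | ⟨i, b⟩) | i) (((⟨⟨s', b'⟩, j'⟩) | ⟨i', b'⟩) | i')
    all_goals
      simp [Matrix.sum_apply, Matrix.single_apply, cycleLayout, coverMatrix,
        Matrix.blockDiagonal_apply, coverShift_apply, Equiv.Perm.permMatrix, PEquiv.toMatrix_apply,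
        Matrix.one_apply, Fintype.sum_prod_type, ite_and]
    by_cases hj : j = j' <;> simp [hj]
  rw [spectralSum_eq_singularSum, ← singularSum_submatrix f
    ((cycleLayout.trans (Equiv.sumCongr α (Equiv.refl _))).trans e)
    ((cycleLayout.trans (Equiv.sumCongr β (Equiv.refl _))).trans e), key,
    singularSum_fromBlocks, singularSum_fromBlocks, singularSum_blockDiagonal_const,
    singularSum_smul_one f hε, singularSum_smul_one f le_rfl]
  simp

end Reduction

/-! ### The space bound -/

/-- Averaging fixes the random string. The sets need not be measurable, so they are replaced by
measurable hulls of the same measure. -/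
theorem exists_card_le_of_measure_le {Ω : Type*} [MeasurableSpace Ω] (μ : Measure Ω)
    [IsProbabilityMeasure μ] {K : Type*} [Fintype K] (bad : K → Set Ω) {δ : ℝ} (hδ : 0 ≤ δ)
    (h : ∀ k, μ (bad k) ≤ ENNReal.ofReal δ) :
    ∃ ω, ∑ k, (bad k).indicator (fun _ => (1 : ℝ)) ω ≤ Fintype.card K * δ := by
  have hmeas : ∀ k, MeasurableSet (toMeasurable μ (bad k)) := fun k => measurableSet_toMeasurable _ _
  obtain ⟨ω, hω⟩ := exists_le_lintegral (μ := μ)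
    (f := fun ω => ∑ k, (toMeasurable μ (bad k)).indicator (fun _ => (1 : ENNReal)) ω)
    (Finset.measurable_sum _ fun k _ => measurable_const.indicator (hmeas k)).aemeasurable
  rw [lintegral_finsetSum _ fun k _ => measurable_const.indicator (hmeas k)] at hω
  simp only [lintegral_indicator_const (hmeas _), one_mul, measure_toMeasurable] at hω
  have h1 := hω.trans (Finset.sum_le_sum fun k _ => h k)
  refine ⟨ω, ?_⟩
  rw [← ENNReal.ofReal_le_ofReal_iff (by positivity), ENNReal.ofReal_sum_of_nonneg
    fun k _ => Set.indicator_nonneg (fun _ _ => zero_le_one) _, ENNReal.ofReal_mul (by positivity)]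
  refine le_trans (Finset.sum_le_sum fun k _ => ?_) (h1.trans (by simp))
  by_cases hk : ω ∈ bad k
  · rw [Set.indicator_of_mem hk, Set.indicator_of_mem (subset_toMeasurable μ _ hk)]
    simp
  · rw [Set.indicator_of_notMem hk]
    simp

theorem StreamingAlgorithm.memoryFrom_append {N S : ℕ} (A : StreamingAlgorithm N S) (ω : A.Ω)
    (k : ℕ) (y : Fin S → Bool) (s₁ s₂ : List (Update N)) :
    A.memoryFrom ω k y (s₁ ++ s₂) =
      A.memoryFrom ω (k + s₁.length) (A.memoryFrom ω k y s₁) s₂ := by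
  induction s₁ generalizing k y with
  | nil => rfl
  | cons a s ih =>
    simp only [List.cons_append, StreamingAlgorithm.memoryFrom, ih, List.length_cons]
    congr 1
    omega

/-- An algorithm which tells the two covers apart yields a protocol for the parities. -/
theorem one_sub_le_sum_levelBound {r t u v N S : ℕ} [NeZero t] (ht : 2 ≤ t)
    (e : (((Fin r × Fin t) ⊕ Fin u) × ZMod 2) ⊕ Fin v ≃ Fin N) {ε : ℝ} (hε : 0 ≤ ε) (f : ℝ → ℝ)
    {c δ : ℝ} (hδ : 0 ≤ δ) (A : StreamingAlgorithm N S)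
    (hA : A.Approximates (spectralSum f) c δ (IsInsertionStream ε)) (F : ZMod 2 → ℝ)
    (hF : ∀ p, F p = r * singularSum f (ε • (coverMatrix p : Matrix (Fin t × ZMod 2) _ ℝ)) +
      u * 2 * f ε + v * f 0)
    (hsep : c * |F 0| + c * |F 1| < |F 0 - F 1|) :
    1 - 2 * δ ≤ ∑ k ∈ Finset.Icc 1 r, levelBound (r * t + u) S t r k := by
  classical
  set w : Equiv.Perm ((Fin r × Fin t) ⊕ Fin u) → ((Fin r × Fin t) ⊕ Fin u → ZMod 2) → ZMod 2 →
    Fin r → ZMod 2 := fun π x p j => edgeParity π x j + p with hw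
  set stream : Equiv.Perm ((Fin r × Fin t) ⊕ Fin u) → ((Fin r × Fin t) ⊕ Fin u → ZMod 2) →
    ZMod 2 → List (Update N) := fun π x p => itemStream e ε x ++ edgeStream e ε π (w π x p)
    with hstream
  have hspec : ∀ π x p, spectralSum f (streamMatrix (stream π x p)) = F p := by
    intro π x p
    rw [hF, hstream]
    refine spectralSum_reduction e ε f hε x π _ p fun j => ?_
    simp only [hw]
    rw [← add_assoc, CharTwo.add_self_eq_zero, zero_add]
  have hbad : ∀ k : (Equiv.Perm ((Fin r × Fin t) ⊕ Fin u) × ((Fin r × Fin t) ⊕ Fin u → ZMod 2)) ×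
      ZMod 2, A.μ {ω | ¬ |A.answer ω (stream k.1.1 k.1.2 k.2) - F k.2| ≤ c * |F k.2|} ≤
        ENNReal.ofReal δ := by
    intro k
    have := hA _ (isInsertionStream_append e ε ht k.1.2 k.1.1 (w k.1.1 k.1.2 k.2))
    rwa [show spectralSum f (streamMatrix (itemStream e ε k.1.2 ++
      edgeStream e ε k.1.1 (w k.1.1 k.1.2 k.2))) = F k.2 from hspec _ _ _] at this
  let := A.measurableSpace
  have := A.isProbabilityMeasure
  obtain ⟨ω, hω⟩ := exists_card_le_of_measure_le A.μ _ hδ hbad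
  set msg : ((Fin r × Fin t) ⊕ Fin u → ZMod 2) → (Fin S → Bool) := fun x =>
    A.memoryFrom ω 0 (A.init ω) (itemStream e ε x) with hmsg
  -- Bob resumes the algorithm from the message and accepts if the answer is close to `F 0`. Stream
  -- lengths do not depend on the inputs, so the update counter carries no information.
  set G : Equiv.Perm ((Fin r × Fin t) ⊕ Fin u) → (Fin S → Bool) → (Fin r → ZMod 2) → ℝ :=
    fun π z y => if |A.output ω ((r * t + u) * 2 + r * t * 2)
      (A.memoryFrom ω ((r * t + u) * 2) z (edgeStream e ε π y)) - F 0| ≤ c * |F 0| then 1 else 0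
    with hG
  have hG0 : ∀ π z y, 0 ≤ G π z y := by
    intro π z y
    simp only [hG]
    split_ifs <;> norm_num
  have hG1 : ∀ π z y, G π z y ≤ 1 := by
    intro π z y
    simp only [hG]
    split_ifs <;> norm_num
  have hans : ∀ π x p, A.answer ω (stream π x p) = A.output ω ((r * t + u) * 2 + r * t * 2)
      (A.memoryFrom ω ((r * t + u) * 2) (msg x) (edgeStream e ε π (w π x p))) := by
    intro π x p
    rw [hstream, StreamingAlgorithm.answer, StreamingAlgorithm.memoryFrom_append,
      List.length_append, length_itemStream, length_edgeStream, zero_add]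
  set B : (Equiv.Perm ((Fin r × Fin t) ⊕ Fin u) × ((Fin r × Fin t) ⊕ Fin u → ZMod 2)) →
      ZMod 2 → ℝ := fun k p =>
    {ω | ¬ |A.answer ω (stream k.1 k.2 p) - F p| ≤ c * |F p|}.indicator (fun _ => (1 : ℝ)) ω
    with hB
  have hpt : ∀ π x, 1 - (B (π, x) 0 + B (π, x) 1) ≤
      G π (msg x) (edgeParity π x) - G π (msg x) (edgeParity π x + 1) := by
    intro π x
    have h0 : 1 - B (π, x) 0 ≤ G π (msg x) (edgeParity π x) := by
      by_cases hb : ω ∈ {ω | ¬ |A.answer ω (stream π x 0) - F 0| ≤ c * |F 0|}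
      · simp only [hB, Set.indicator_of_mem hb, sub_self]
        exact hG0 _ _ _
      · have hb' : |A.answer ω (stream π x 0) - F 0| ≤ c * |F 0| := not_not.1 hb
        rw [hans, show w π x 0 = edgeParity π x by ext j; simp [hw]] at hb'
        simp only [hB, Set.indicator_of_notMem hb, hG, if_pos hb', sub_zero, le_refl]
    have h1 : G π (msg x) (edgeParity π x + 1) ≤ B (π, x) 1 := by
      by_cases hb : ω ∈ {ω | ¬ |A.answer ω (stream π x 1) - F 1| ≤ c * |F 1|}
      · simp only [hB, Set.indicator_of_mem hb]
        exact hG1 _ _ _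
      · have hb' : |A.answer ω (stream π x 1) - F 1| ≤ c * |F 1| := not_not.1 hb
        rw [hans, show w π x 1 = edgeParity π x + 1 by ext j; simp [hw]] at hb'
        simp only [hB, Set.indicator_of_notMem hb, hG]
        rw [if_neg]
        intro hcon
        have htri := abs_sub_le (F 0) (A.output ω ((r * t + u) * 2 + r * t * 2)
          (A.memoryFrom ω ((r * t + u) * 2) (msg x) (edgeStream e ε π (edgeParity π x + 1)))) (F 1)
        rw [abs_sub_comm (F 0) (A.output _ _ _)] at htri
        linarith
    linarith
  have hadv := sum_parity_advantage_le (by omega : 1 ≤ t) (S := S) (by simp) msg G hG0 hG1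
  set P : ℝ := (Fintype.card (Equiv.Perm ((Fin r × Fin t) ⊕ Fin u)) : ℝ) with hP
  set Q : ℝ := (Fintype.card ((Fin r × Fin t) ⊕ Fin u → ZMod 2) : ℝ) with hQ
  have hPQ : 0 < P * Q := by
    have h1 : 0 < Fintype.card (Equiv.Perm ((Fin r × Fin t) ⊕ Fin u)) := Fintype.card_pos
    have h2 : 0 < Fintype.card ((Fin r × Fin t) ⊕ Fin u → ZMod 2) := Fintype.card_pos
    positivity
  have hsum : ∑ π, ∑ x, (B (π, x) 0 + B (π, x) 1) ≤ P * Q * 2 * δ := by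
    refine le_trans (le_of_eq ?_) (hω.trans (le_of_eq ?_))
    · rw [Fintype.sum_prod_type, Fintype.sum_prod_type]
      refine Finset.sum_congr rfl fun π _ => Finset.sum_congr rfl fun x _ => ?_
      exact (Fin.sum_univ_two fun p : Fin 2 => B (π, x) p).symm
    · rw [Fintype.card_prod, Fintype.card_prod, ZMod.card]
      push_cast
      ring
  have hlow := Finset.sum_le_sum fun π (_ : π ∈ Finset.univ) =>
    Finset.sum_le_sum fun x (_ : x ∈ Finset.univ) => hpt π x
  have hcount : ∑ π, ∑ x, (1 - (B (π, x) 0 + B (π, x) 1)) =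
      P * Q - ∑ π, ∑ x, (B (π, x) 0 + B (π, x) 1) := by
    rw [Finset.sum_congr rfl fun π _ => Finset.sum_sub_distrib _ _, Finset.sum_sub_distrib]
    simp only [Finset.sum_const, Finset.card_univ, nsmul_eq_mul, mul_one]
    rfl
  rw [hcount] at hlow
  refine le_of_mul_le_mul_left ?_ hPQ
  calc P * Q * (1 - 2 * δ) = P * Q - P * Q * 2 * δ := by ring
    _ ≤ _ := by linarith

theorem mainTheorem7 (f : ℝ → ℝ) (a : ℕ → ℝ) (hf : HasTaylorExpansion f a)
    (ha : {k : ℕ | Even k ∧ a k ≠ 0}.Infinite) (m : ℕ) (hm : 1 ≤ m) :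
    ∃ c : ℝ, 0 < c ∧ ∃ q : ℕ, 1 ≤ q ∧
      ∀ δ : ℝ, 0 < δ → δ < 1 / 2 → ∃ C : ℝ, 0 < C ∧ ∃ N₀ : ℕ, ∀ N : ℕ, N₀ ≤ N →
        ∀ (S : ℕ) (A : StreamingAlgorithm N S),
          A.Approximates (spectralSum f) c δ (IsInsertionStream (1 / (q : ℝ))) →
            C * (N : ℝ) ^ (1 - 1 / (m : ℝ)) ≤ (S : ℝ) := by
  obtain ⟨q, hq, hne⟩ := exists_singularSum_coverMatrix_ne hf ha (m + 2)
  set ε : ℝ := 1 / q with hε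
  have hε0 : 0 ≤ ε := by positivity
  set Φ : ZMod 2 → ℝ := fun p =>
    singularSum f (ε • (coverMatrix p : Matrix (Fin (m + 2) × ZMod 2) _ ℝ)) with hΦ
  set M : ℝ := |Φ 0| + |Φ 1| + |f ε| + |f 0| with hM
  have hM0 : 0 ≤ M := by positivity
  have hgap : 0 < |Φ 0 - Φ 1| := abs_pos.2 (sub_ne_zero.2 hne)
  -- Both values are at most `N * M ≤ 3072 r (m + 2) M` in absolute value, so the two error
  -- intervals have total radius at most `6144 c r (m + 2) M`; `M + 1` makes this strictly less than
  -- the gap `r |Φ 0 - Φ 1|`.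
  set c : ℝ := |Φ 0 - Φ 1| / (6144 * (m + 2) * (M + 1)) with hc
  have hc0 : 0 < c := by positivity
  -- `C = 1` works for every `δ` because the advantage tends to `0`; only the threshold for `N`
  -- depends on `δ`.
  refine ⟨c, hc0, q, hq, fun δ hδ0 hδ => ⟨1, one_pos, ?_⟩⟩
  obtain ⟨N₀, hN₀⟩ := exists_sum_levelBound_le hm (by linarith : 0 < (1 - 2 * δ) / 2)
  refine ⟨N₀, fun N hN S A hA => ?_⟩
  obtain ⟨r, hr1, hr2, hr3, hS⟩ := hN₀ N hN
  rw [one_mul]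
  by_contra! hcon
  have hsmall := hS S hcon
  obtain ⟨v, hv⟩ := Nat.exists_eq_add_of_le hr2
  have e : (((Fin r × Fin (m + 2)) ⊕ Fin (767 * (r * (m + 2)))) × ZMod 2) ⊕ Fin v ≃ Fin N := by
    refine Fintype.equivFinOfCardEq ?_
    simp only [Fintype.card_sum, Fintype.card_prod, Fintype.card_fin, ZMod.card]
    omega
  set F : ZMod 2 → ℝ := fun p => r * Φ p + (767 * (r * (m + 2)) : ℕ) * 2 * f ε + v * f 0 with hF
  have hvR : (N : ℝ) = 1536 * (r * (m + 2)) + v := by exact_mod_cast hv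
  have hr3R : (N : ℝ) ≤ 3072 * (r * (m + 2)) := by exact_mod_cast hr3
  have hr0 : (1 : ℝ) ≤ r := by exact_mod_cast hr1
  have hm0 : (0 : ℝ) ≤ m := Nat.cast_nonneg m
  have hv0 : (0 : ℝ) ≤ v := Nat.cast_nonneg v
  have hbound : ∀ p, |Φ p| ≤ |Φ 0| + |Φ 1| → |F p| ≤ N * M := by
    intro p hp
    have h1 : (r : ℝ) ≤ N := by nlinarith
    have h2 : (((767 * (r * (m + 2)) : ℕ) : ℝ)) * 2 ≤ N := by
      push_cast
      nlinarith
    have h3 : (v : ℝ) ≤ N := by nlinarith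
    calc |F p| ≤ |r * Φ p| + |((767 * (r * (m + 2)) : ℕ) : ℝ) * 2 * f ε| + |v * f 0| :=
          abs_add_three _ _ _
      _ = r * |Φ p| + ((767 * (r * (m + 2)) : ℕ) : ℝ) * 2 * |f ε| + v * |f 0| := by
          have h4 : (0 : ℝ) ≤ ((767 * (r * (m + 2)) : ℕ) : ℝ) * 2 := by positivity
          rw [abs_mul, abs_mul _ (f ε), abs_mul _ (f 0), abs_of_nonneg (by positivity : (0 : ℝ) ≤ r),
            abs_of_nonneg hv0, abs_of_nonneg h4]
      _ ≤ N * (|Φ 0| + |Φ 1|) + N * |f ε| + N * |f 0| := by gcongr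
      _ = N * M := by
          rw [hM]
          ring
  have hdiff : |F 0 - F 1| = r * |Φ 0 - Φ 1| := by
    rw [hF, ← abs_of_nonneg (by positivity : (0 : ℝ) ≤ r), ← abs_mul]
    congr 1
    rw [abs_of_nonneg (by positivity : (0 : ℝ) ≤ r)]
    ring
  have hsep : c * |F 0| + c * |F 1| < |F 0 - F 1| := by
    rw [hdiff]
    have h0 := hbound 0 (by linarith [abs_nonneg (Φ 1)])
    have h1 := hbound 1 (by linarith [abs_nonneg (Φ 0)])
    calc c * |F 0| + c * |F 1| ≤ c * (N * M) + c * (N * M) := by gcongr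
      _ ≤ c * (3072 * (r * (m + 2)) * M) + c * (3072 * (r * (m + 2)) * M) := by gcongr
      _ = r * |Φ 0 - Φ 1| * (M / (M + 1)) := by
          rw [hc]
          field_simp
          ring
      _ < r * |Φ 0 - Φ 1| := by
          refine mul_lt_of_lt_one_right (by positivity) ?_
          rw [div_lt_one (by positivity)]
          linarith
  have hlow := one_sub_le_sum_levelBound (by omega) e hε0 f hδ0.le A hA F (fun p => rfl) hsep
  rw [show r * (m + 2) + 767 * (r * (m + 2)) = 768 * (r * (m + 2)) by ring] at hlow
  linarith
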